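/- Let $(r_n)_{n\ge1}$ be real numbers with $0\le r_n<\frac23$, $r_n\downarrow0$ (non-increasing with limit $0$) and $r_n-r_{n+1}=O(r_n^2)$ as $n\to\infty$. Put $p_n=\frac13+r_n$, $q_n=1-p_n$ and $a_n=q_n/p_n$ for $n\ge1$. Let $X=(X_k)_{k\ge0}$ be a Markov chain on $\{0,1,2,\dots\}$, with an arbitrary initial distribution, such that $$P(X_{k+1}=n+2\mid X_k=n)=p_n,\quad P(X_{k+1}=n-1\mid X_k=n)=q_n\quad(n\ge1),\qquad P(X_{k+1}=2\mid X_k=0)=1.$$ A site $k\ge0$ is called a skipped point of $X$ if $X_n\ne k$ for all $n\ge0$. Let $(\xi_n)_{n\ge1}$ be the (unique) positive solution of $$\xi_n=\frac1{a_n}\Bigl(1+\frac1{\xi_{n+1}}\Bigr),\qquad n\ge1,$$ let $U_i=1/\xi_i$, and for $m\ge1$ let $$D(m)=\lim_{n\to\infty}\sum_{j=m+1}^{n}\ \prod_{i=m+1}^{j-1}U_i\in[1,\infty],$$ where the empty product equals $1$ and $1/\infty=0$. (i) If $\sum_{n=2}^\infty\frac{1}{D(n)\log n}<\infty$, then almost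 surely $X$ has at most finitely many skipped points. (ii) If there is $\delta>0$ such that $D(n)\le\delta n\log n$ for all sufficiently large $n$, and $\sum_{n=2}^\infty\frac1{D(n)\log n}=\infty$, then with probability at least $\frac{11}{27}$ the chain $X$ has infinitely many skipped points. -/

import Mathlib

open MeasureTheory Filter Topology
open scoped ENNReal

namespace SkipWalk

/-- One-step transition probabilities of the (1,2) random walk on `{0, 1, 2, ...}`: from `n ≥ 1` it
jumps to `n + 2` with probability `p n` and to `n - 1` with probability `1 - p n`; from `0` it
jumps to `2`. (The value `p 0` plays no role.) -/
noncomputable def trans (p : ℕ → ℝ) (n m : ℕ) : ℝ :=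
  if n = 0 then (if m = 2 then 1 else 0)
  else if m = n + 2 then p n
  else if m + 1 = n then 1 - p n
  else 0

/-- `X` is a Markov chain under `P` with transition matrix `trans p`, with arbitrary initial law:
`P(X₀ = x₀, ..., Xₖ₊₁ = xₖ₊₁) = P(X₀ = x₀, ..., Xₖ = xₖ) * trans p xₖ xₖ₊₁`. -/
structure IsWalk {Ω : Type*} [MeasurableSpace Ω] (P : Measure Ω) (p : ℕ → ℝ)
    (X : ℕ → Ω → ℕ) : Prop where
  measurable : ∀ k, Measurable (X k)
  markov : ∀ (k : ℕ) (x : ℕ → ℕ),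
    P {ω | ∀ i ≤ k + 1, X i ω = x i} =
      P {ω | ∀ i ≤ k, X i ω = x i} * ENNReal.ofReal (trans p (x k) (x (k + 1)))

/-- The set of skipped points of the trajectory `ω`: the sites that are never visited. -/
def skipped {Ω : Type*} (X : ℕ → Ω → ℕ) (ω : Ω) : Set ℕ :=
  {k | ∀ n, X n ω ≠ k}

/-- `a n = q n / p n`. -/
noncomputable def ratio (p : ℕ → ℝ) (n : ℕ) : ℝ := (1 - p n) / p n

/-- `ξ 1, ξ 2, ...` is a positive solution of `ξ n = (1 / a n) * (1 + 1 / ξ (n + 1))`, `n ≥ 1`. -/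
def IsTailSolution (p : ℕ → ℝ) (ξ : ℕ → ℝ) : Prop :=
  ∀ n, 1 ≤ n → 0 < ξ n ∧ ξ n = 1 / ratio p n * (1 + 1 / ξ (n + 1))

/-- `D(m, n) = ∑_{j = m+1}^{n} ∏_{i = m+1}^{j-1} U i` with `U i = 1 / ξ i`
(the empty product is `1`). -/
noncomputable def DFin (ξ : ℕ → ℝ) (m n : ℕ) : ℝ :=
  ∑ j ∈ Finset.Icc (m + 1) n, ∏ i ∈ Finset.Ico (m + 1) j, 1 / ξ i

/-- `D(m) = lim_n D(m, n)`, with values in `[0, ∞]`; the sequence is nondecreasing, so that its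
limit is its supremum (see `tendsto_DFin`). -/
noncomputable def D (ξ : ℕ → ℝ) (m : ℕ) : ℝ≥0∞ := ⨆ n, ENNReal.ofReal (DFin ξ m n)

theorem tendsto_DFin {p ξ : ℕ → ℝ} (h : IsTailSolution p ξ) (m : ℕ) :
    Tendsto (fun n => ENNReal.ofReal (DFin ξ m n)) atTop (𝓝 (D ξ m)) := by
  refine tendsto_atTop_iSup fun a b hab => ENNReal.ofReal_le_ofReal ?_
  refine Finset.sum_le_sum_of_subset_of_nonneg (Finset.Icc_subset_Icc_right hab) ?_
  intro j _ _
  refine Finset.prod_nonneg fun i hi => ?_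
  have := (h i (by have := (Finset.mem_Ico.1 hi).1; omega)).1
  positivity

/-- `∑_{n ≥ 2} 1 / (D(n) log n)`, with values in `[0, ∞]` (and `1 / ∞ = 0`). -/
noncomputable def critSum (ξ : ℕ → ℝ) : ℝ≥0∞ :=
  ∑' n : ℕ, 1 / (D ξ (n + 2) * ENNReal.ofReal (Real.log ((n + 2 : ℕ) : ℝ)))

end SkipWalk

/-!
For fixed `m` the function `DFin ξ m` is harmonic for the walk on `(m, ∞)`, so optional stopping
gives `P(never hit m | start at m + 1) = 1 / D(m)`. A walk that starts below `k` jumps over `k`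
at its first passage with probability bounded below, and it skips `k` iff it then never comes
back; hence `P(k skipped) ≍ 1 / D(k)` and
`P(k and l skipped) ≤ 1 / (D(k, l) D(l))` for `k < l`.

If the series converges: given the last skipped point `k` of a dyadic block, a point `k - d` is
skipped with conditional probability at least of order `1 / (d + 1)`, because `U ≤ 1` forces
`D(k - d, k) ≤ d`. One skipped point therefore brings along of order `log k` others on average,
so that the block contains a skipped point with probability at most of order
`∑ 1 / (D(k) log k)` over the block and its predecessor, and Borel-Cantelli applies.

If the series diverges: the second moment method for the number of skipped points `k`, weighted by
`1 / log k`, gives infinitely many of them with a probability that is bounded below uniformly in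
the past of the walk, and Lévy's zero-one law turns this into probability one.
-/

namespace SkipWalk

section TailSolution

variable {p ξ : ℕ → ℝ}

theorem IsTailSolution.one_div_pos (hξ : IsTailSolution p ξ) {n : ℕ} (hn : 1 ≤ n) :
    0 < 1 / ξ n :=
  _root_.one_div_pos.2 (hξ n hn).1

theorem IsTailSolution.one_div_eq (hξ : IsTailSolution p ξ) {n : ℕ} (hn : 1 ≤ n) :
    1 / ξ n = ratio p n / (1 + 1 / ξ (n + 1)) := by
  rw [(hξ n hn).2, one_div_mul_eq_div, one_div_div]

theorem IsTailSolution.ratio_pos (hξ : IsTailSolution p ξ) {n : ℕ} (hn : 1 ≤ n) :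
    0 < ratio p n := by
  have hdiv := hξ.one_div_eq hn ▸ hξ.one_div_pos hn
  have hden : 0 < 1 + 1 / ξ (n + 1) := by linarith [hξ.one_div_pos (n := n + 1) (by omega)]
  exact (div_pos_iff_of_pos_right hden).1 hdiv

theorem IsTailSolution.mem_Ioo (hξ : IsTailSolution p ξ) {n : ℕ} (hn : 1 ≤ n) :
    p n ∈ Set.Ioo 0 1 := by
  rcases div_pos_iff.1 (hξ.ratio_pos hn) with ⟨hq, hp⟩ | ⟨hq, hp⟩
  · exact ⟨hp, by linarith⟩
  · linarith

theorem ratio_le_ratio_of_le {m n : ℕ} (hn : 0 < p n) (hmn : p n ≤ p m) :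
    ratio p m ≤ ratio p n := by
  rw [ratio, ratio, div_le_div_iff₀ (hn.trans_le hmn) hn]
  linarith

theorem ratio_le_two {n : ℕ} (hn : 1 / 3 ≤ p n) : ratio p n ≤ 2 := by
  rw [ratio, div_le_iff₀ (by linarith)]
  linarith

theorem IsTailSolution.one_div_le_ratio (hξ : IsTailSolution p ξ) {n : ℕ} (hn : 1 ≤ n) :
    1 / ξ n ≤ ratio p n := by
  rw [hξ.one_div_eq hn]
  exact div_le_self (hξ.ratio_pos hn).le
    (le_add_of_nonneg_right (hξ.one_div_pos (n := n + 1) (by omega)).le)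

theorem IsTailSolution.one_div_le_of_forall_le (hξ : IsTailSolution p ξ)
    (hp : ∀ n, 1 ≤ n → 1 / 3 ≤ p n) (hanti : ∀ n, 1 ≤ n → p (n + 1) ≤ p n) {s : ℝ}
    (hs : ∀ n, 1 ≤ n → 1 / ξ n ≤ s) {n : ℕ} (hn : 1 ≤ n) :
    1 / ξ n ≤ 2 * (1 + s) / (3 + s) := by
  have hs_pos : 0 < s := (hξ.one_div_pos hn).trans_le (hs n hn)
  have ha := hξ.ratio_pos hn
  have hnext : ratio p n / (1 + s) ≤ 1 / ξ (n + 1) := by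
    rw [hξ.one_div_eq (n := n + 1) (by omega)]
    have hden := hξ.one_div_pos (n := n + 1 + 1) (by omega)
    exact div_le_div₀ (hξ.ratio_pos (n := n + 1) (by omega)).le
      (ratio_le_ratio_of_le (hξ.mem_Ioo (n := n + 1) (by omega)).1 (hanti n hn)) (by linarith)
      (by linarith [hs (n + 1 + 1) (by omega)])
  calc 1 / ξ n = ratio p n / (1 + 1 / ξ (n + 1)) := hξ.one_div_eq hn
    _ ≤ ratio p n / (1 + ratio p n / (1 + s)) := by gcongr
    _ ≤ 2 * (1 + s) / (3 + s) := by
      rw [div_le_div_iff₀ (by positivity) (by positivity)]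
      have hexpand : 2 * (1 + s) * (1 + ratio p n / (1 + s)) = 2 * (1 + s) + 2 * ratio p n := by
        field_simp
      nlinarith [ratio_le_two (hp n hn)]

theorem IsTailSolution.one_div_le_one (hξ : IsTailSolution p ξ)
    (hp : ∀ n, 1 ≤ n → 1 / 3 ≤ p n) (hanti : ∀ n, 1 ≤ n → p (n + 1) ≤ p n) {n : ℕ}
    (hn : 1 ≤ n) : 1 / ξ n ≤ 1 := by
  set s := ⨆ i, 1 / ξ (i + 1)
  have hbdd : BddAbove (Set.range fun i => 1 / ξ (i + 1)) := by
    refine ⟨2, Set.forall_mem_range.2 fun i => ?_⟩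
    exact (hξ.one_div_le_ratio (by omega)).trans (ratio_le_two (hp _ (by omega)))
  have hs : ∀ n, 1 ≤ n → 1 / ξ n ≤ s := fun n hn => by
    obtain ⟨i, rfl⟩ := Nat.exists_eq_add_of_le' hn
    exact le_ciSup hbdd i
  have hs_pos : 0 < s := (hξ.one_div_pos hn).trans_le (hs n hn)
  have hs_le : s ≤ 2 * (1 + s) / (3 + s) :=
    ciSup_le fun i => hξ.one_div_le_of_forall_le hp hanti hs (by omega)
  rw [le_div_iff₀ (by linarith)] at hs_le
  have hs_one : s ≤ 1 := by nlinarith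
  exact (hs n hn).trans hs_one

theorem DFin_of_le (ξ : ℕ → ℝ) {m n : ℕ} (h : n ≤ m) : DFin ξ m n = 0 := by
  rw [DFin, Finset.Icc_eq_empty (by omega), Finset.sum_empty]

theorem DFin_succ (ξ : ℕ → ℝ) {m n : ℕ} (h : m ≤ n) :
    DFin ξ m (n + 1) = DFin ξ m n + ∏ i ∈ Finset.Ico (m + 1) (n + 1), 1 / ξ i := by
  rw [DFin, DFin, Finset.sum_Icc_succ_top (by omega)]

theorem DFin_self_succ (ξ : ℕ → ℝ) (m : ℕ) : DFin ξ m (m + 1) = 1 := by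
  rw [DFin_succ ξ le_rfl, DFin_of_le ξ le_rfl, Finset.Ico_self, Finset.prod_empty, zero_add]

theorem DFin_add (ξ : ℕ → ℝ) {k l n : ℕ} (hkl : k ≤ l) (hln : l ≤ n) :
    DFin ξ k n = DFin ξ k l + (∏ i ∈ Finset.Ico (k + 1) (l + 1), 1 / ξ i) * DFin ξ l n := by
  induction n, hln using Nat.le_induction with
  | base => rw [DFin_of_le ξ le_rfl, mul_zero, add_zero]
  | succ n hn ih =>
    rw [DFin_succ ξ (hkl.trans hn), DFin_succ ξ hn, ih, mul_add,
      Finset.prod_Ico_consecutive _ (by omega) (by omega), add_assoc]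

theorem IsTailSolution.prod_one_div_pos (hξ : IsTailSolution p ξ) (m n : ℕ) :
    0 < ∏ i ∈ Finset.Ico (m + 1) n, 1 / ξ i :=
  Finset.prod_pos fun i hi => hξ.one_div_pos (by have := (Finset.mem_Ico.1 hi).1; omega)

theorem IsTailSolution.prod_one_div_le_one (hξ : IsTailSolution p ξ)
    (hU : ∀ n, 1 ≤ n → 1 / ξ n ≤ 1) (m n : ℕ) :
    ∏ i ∈ Finset.Ico (m + 1) n, 1 / ξ i ≤ 1 := by
  have one_le : ∀ i ∈ Finset.Ico (m + 1) n, 1 ≤ i := fun i hi => by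
    have := (Finset.mem_Ico.1 hi).1
    omega
  exact Finset.prod_le_one (fun i hi => (hξ.one_div_pos (one_le i hi)).le)
    fun i hi => hU i (one_le i hi)

theorem IsTailSolution.DFin_mono (hξ : IsTailSolution p ξ) (m : ℕ) : Monotone (DFin ξ m) := by
  refine monotone_nat_of_le_succ fun n => ?_
  rcases le_or_gt m n with hn | hn
  · rw [DFin_succ ξ hn]
    exact le_add_of_nonneg_right (hξ.prod_one_div_pos m (n + 1)).le
  · rw [DFin_of_le ξ hn.le, DFin_of_le ξ (by omega)]

theorem IsTailSolution.one_le_DFin (hξ : IsTailSolution p ξ) {m n : ℕ} (hmn : m < n) :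
    1 ≤ DFin ξ m n := by
  rw [← DFin_self_succ ξ m]
  exact hξ.DFin_mono m hmn

theorem IsTailSolution.DFin_nonneg (hξ : IsTailSolution p ξ) (m n : ℕ) : 0 ≤ DFin ξ m n := by
  rcases le_or_gt n m with hn | hn
  · rw [DFin_of_le ξ hn]
  · exact zero_le_one.trans (hξ.one_le_DFin hn)

theorem IsTailSolution.DFin_le_sub (hξ : IsTailSolution p ξ) (hU : ∀ n, 1 ≤ n → 1 / ξ n ≤ 1)
    {m n : ℕ} (hmn : m ≤ n) : DFin ξ m n ≤ n - m := by
  induction n, hmn using Nat.le_induction with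
  | base => rw [DFin_of_le ξ le_rfl, sub_self]
  | succ n hn ih =>
    rw [DFin_succ ξ hn]
    push_cast
    linarith [hξ.prod_one_div_le_one hU m (n + 1)]

theorem IsTailSolution.DFin_harmonic (hξ : IsTailSolution p ξ) {m n : ℕ} (hmn : m ≤ n) :
    p (n + 1) * DFin ξ m (n + 3) + (1 - p (n + 1)) * DFin ξ m n = DFin ξ m (n + 1) := by
  have hp := (hξ.mem_Ioo (n := n + 1) (by omega)).1.ne'
  have hnext := hξ.one_div_pos (n := n + 2) (by omega)
  have hrec : 1 / ξ (n + 1) * (1 + 1 / ξ (n + 2)) * p (n + 1) = 1 - p (n + 1) := by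
    rw [← eq_div_iff hp, ← eq_div_iff (by linarith)]
    exact hξ.one_div_eq (by omega)
  rw [DFin_succ ξ (show m ≤ n + 2 by omega), DFin_succ ξ (show m ≤ n + 1 by omega),
    DFin_succ ξ hmn, Finset.prod_Ico_succ_top (show m + 1 ≤ n + 2 by omega),
    Finset.prod_Ico_succ_top (show m + 1 ≤ n + 1 by omega)]
  linear_combination (∏ i ∈ Finset.Ico (m + 1) (n + 1), 1 / ξ i) * hrec

theorem DFin_le_D (ξ : ℕ → ℝ) (m n : ℕ) : ENNReal.ofReal (DFin ξ m n) ≤ D ξ m :=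
  le_iSup (fun n => ENNReal.ofReal (DFin ξ m n)) n

theorem one_le_D (ξ : ℕ → ℝ) (m : ℕ) : 1 ≤ D ξ m := by
  simpa only [DFin_self_succ, ENNReal.ofReal_one] using DFin_le_D ξ m (m + 1)

theorem IsTailSolution.tendsto_DFin_toReal (hξ : IsTailSolution p ξ) {m : ℕ} (hm : D ξ m ≠ ∞) :
    Tendsto (DFin ξ m) atTop (𝓝 (D ξ m).toReal) :=
  ((ENNReal.tendsto_toReal hm).comp (tendsto_DFin hξ m)).congr fun n =>
    ENNReal.toReal_ofReal (hξ.DFin_nonneg m n)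

theorem IsTailSolution.toReal_D_add (hξ : IsTailSolution p ξ) {k l : ℕ} (hkl : k ≤ l)
    (hk : D ξ k ≠ ∞) (hl : D ξ l ≠ ∞) :
    (D ξ k).toReal =
      DFin ξ k l + (∏ i ∈ Finset.Ico (k + 1) (l + 1), 1 / ξ i) * (D ξ l).toReal := by
  refine tendsto_nhds_unique (hξ.tendsto_DFin_toReal hk) ?_
  refine (tendsto_const_nhds.add ((hξ.tendsto_DFin_toReal hl).const_mul _)).congr' ?_
  filter_upwards [eventually_ge_atTop l] with n hn
  rw [DFin_add ξ hkl hn]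

end TailSolution

/-- The trajectory of `ω` as a path. -/
abbrev traj {Ω E : Type*} (X : ℕ → Ω → E) (ω : Ω) : ℕ → E := fun t => X t ω

section MarkovProperty

variable {Ω : Type*} [MeasurableSpace Ω] {P : Measure Ω} {p : ℕ → ℝ} {X : ℕ → Ω → ℕ}

theorem measure_eq_tsum_fiber {ι : Type*} [Countable ι] (P : Measure Ω) {g : Ω → ι}
    (hg : ∀ i, MeasurableSet (g ⁻¹' {i})) (S : Set Ω) : P S = ∑' i, P (S ∩ g ⁻¹' {i}) := by
  have hrestrict : ∀ i, P (S ∩ g ⁻¹' {i}) = P.restrict S (g ⁻¹' {i}) := fun i => by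
    rw [Measure.restrict_apply (hg i), Set.inter_comm]
  simp_rw [hrestrict]
  rw [← measure_iUnion (fun i j hij => Disjoint.preimage g (by simpa using hij)) hg,
    ← Set.preimage_iUnion, Set.iUnion_of_singleton, Set.preimage_univ, Measure.restrict_apply_univ]

theorem setLIntegral_comp_eq_tsum_fiber {ι : Type*} [Countable ι] [MeasurableSpace ι]
    [DiscreteMeasurableSpace ι] (P : Measure Ω) {Y : Ω → ι} (hY : Measurable Y) (f : ι → ℝ≥0∞)
    (C : Set Ω) : ∫⁻ ω in C, f (Y ω) ∂P = ∑' b, f b * P (C ∩ Y ⁻¹' {b}) := by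
  rw [← lintegral_map (f := f) Measurable.of_discrete hY, lintegral_countable']
  refine tsum_congr fun b => ?_
  rw [Measure.map_apply hY (measurableSet_singleton b),
    Measure.restrict_apply (hY (measurableSet_singleton b)), Set.inter_comm]

theorem IsWalk.measurable_traj (hX : IsWalk P p X) : Measurable (traj X) :=
  measurable_pi_lambda _ hX.measurable

/-- The natural filtration of the walk: `hX.past t` is the σ-algebra of the events determined by
`X 0, ..., X t`. -/
noncomputable def IsWalk.past (hX : IsWalk P p X) : Filtration ℕ ‹MeasurableSpace Ω› :=
  Filtration.natural X fun k => (hX.measurable k).stronglyMeasurable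

theorem IsWalk.measurable_past (hX : IsWalk P p X) {s t : ℕ} (hst : s ≤ t) :
    Measurable[hX.past t] (X s) :=
  (Filtration.stronglyAdapted_natural (fun k => (hX.measurable k).stronglyMeasurable)
    s).measurable.mono (hX.past.mono hst) le_rfl

theorem IsWalk.mem_of_past (hX : IsWalk P p X) {t : ℕ} {C : Set Ω} (hC : MeasurableSet[hX.past t] C)
    {ω ω' : Ω} (hω : ω ∈ C) (heq : ∀ i ≤ t, X i ω' = X i ω) : ω' ∈ C := by
  rw [IsWalk.past, Filtration.natural_eq_comap] at hC
  obtain ⟨B, -, rfl⟩ := hC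
  have hpath : (fun j : Set.Iic t => X j ω') = fun j : Set.Iic t => X j ω :=
    funext fun j => heq j j.2
  rwa [Set.mem_preimage, hpath]

theorem IsWalk.measure_prefix_inter (hX : IsWalk P p X) (k : ℕ) (x : ℕ → ℕ) (b : ℕ) :
    P ({ω | ∀ i ≤ k, X i ω = x i} ∩ X (k + 1) ⁻¹' {b}) =
      P {ω | ∀ i ≤ k, X i ω = x i} * ENNReal.ofReal (trans p (x k) b) := by
  have hx : ∀ i ≤ k, Function.update x (k + 1) b i = x i := fun i hi =>
    Function.update_of_ne (by omega) _ _
  have hmarkov := hX.markov k (Function.update x (k + 1) b)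
  rw [Function.update_self, hx k le_rfl] at hmarkov
  convert hmarkov using 2
  · ext ω
    simp only [Nat.le_succ_iff, or_imp, forall_and, forall_eq, Function.update_self,
      Set.mem_inter_iff, Set.mem_ofPred_eq, Set.mem_preimage, Set.mem_singleton_iff]
    exact and_congr_left' (forall₂_congr fun i hi => by rw [hx i hi])
  · congr 1
    ext ω
    exact forall₂_congr fun i hi => by rw [hx i hi]

theorem IsWalk.measure_step (hX : IsWalk P p X) {t : ℕ} {C : Set Ω}
    (hC : MeasurableSet[hX.past t] C) {a : ℕ} (ha : ∀ ω ∈ C, X t ω = a) (b : ℕ) :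
    P (C ∩ X (t + 1) ⁻¹' {b}) = P C * ENNReal.ofReal (trans p a b) := by
  let path : Ω → Set.Iic t → ℕ := fun ω j => X j ω
  have hpath : ∀ y, MeasurableSet (path ⁻¹' {y}) := fun y =>
    (measurable_pi_lambda path fun j => hX.measurable j) (measurableSet_singleton y)
  rw [measure_eq_tsum_fiber P hpath, measure_eq_tsum_fiber P hpath C, ← ENNReal.tsum_mul_right]
  refine tsum_congr fun y => ?_
  rw [Set.inter_right_comm]
  rcases (C ∩ path ⁻¹' {y}).eq_empty_or_nonempty with hempty | ⟨ω₀, hω₀, rfl⟩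
  · rw [hempty, Set.empty_inter, measure_empty, zero_mul]
  · have hfiber : C ∩ path ⁻¹' {path ω₀} = {ω | ∀ i ≤ t, X i ω = X i ω₀} := by
      ext ω
      exact ⟨fun h i hi => congrFun h.2 ⟨i, hi⟩,
        fun h => ⟨hX.mem_of_past hC hω₀ h, funext fun j => h j j.2⟩⟩
    rw [hfiber, hX.measure_prefix_inter t fun i => X i ω₀, ha ω₀ hω₀]

/-- The transition operator of the walk. -/
noncomputable def avg (p : ℕ → ℝ) (f : ℕ → ℝ≥0∞) (n : ℕ) : ℝ≥0∞ :=
  ∑' m, ENNReal.ofReal (trans p n m) * f m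

theorem avg_zero (p : ℕ → ℝ) (f : ℕ → ℝ≥0∞) : avg p f 0 = f 2 := by
  rw [avg, tsum_eq_single 2]
  · simp [trans]
  · intro m hm
    simp [trans, hm]

theorem avg_succ (p : ℕ → ℝ) (f : ℕ → ℝ≥0∞) (n : ℕ) :
    avg p f (n + 1) =
      ENNReal.ofReal (p (n + 1)) * f (n + 3) + ENNReal.ofReal (1 - p (n + 1)) * f n := by
  rw [avg, tsum_eq_sum (s := {n + 3, n})]
  · rw [Finset.sum_pair (by omega)]
    simp [trans, show n ≠ n + 1 + 2 by omega]
  · intro m hm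
    simp only [Finset.mem_insert, Finset.mem_singleton, not_or] at hm
    simp [trans, hm]

theorem avg_succ_ofReal {n : ℕ} (hp : p (n + 1) ∈ Set.Icc 0 1) {f : ℕ → ℝ}
    (hf : 0 ≤ f n) (hf' : 0 ≤ f (n + 3)) :
    avg p (fun x => ENNReal.ofReal (f x)) (n + 1) =
      ENNReal.ofReal (p (n + 1) * f (n + 3) + (1 - p (n + 1)) * f n) := by
  have hq : 0 ≤ 1 - p (n + 1) := by linarith [hp.2]
  rw [avg_succ, ENNReal.ofReal_add (mul_nonneg hp.1 hf') (mul_nonneg hq hf),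
    ENNReal.ofReal_mul hp.1, ENNReal.ofReal_mul hq]

theorem IsWalk.setLIntegral_step (hX : IsWalk P p X) {t : ℕ} {C : Set Ω}
    (hC : MeasurableSet[hX.past t] C) (f : ℕ → ℝ≥0∞) :
    ∫⁻ ω in C, f (X (t + 1) ω) ∂P = ∫⁻ ω in C, avg p f (X t ω) ∂P := by
  have hstep : ∀ b, P (C ∩ X (t + 1) ⁻¹' {b}) =
      ∑' a, P (C ∩ X t ⁻¹' {a}) * ENNReal.ofReal (trans p a b) := fun b => by
    rw [measure_eq_tsum_fiber P fun a => hX.measurable t (measurableSet_singleton a)]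
    refine tsum_congr fun a => ?_
    rw [Set.inter_right_comm]
    exact hX.measure_step (hC.inter (hX.measurable_past le_rfl (measurableSet_singleton a)))
      (fun ω hω => hω.2) b
  rw [setLIntegral_comp_eq_tsum_fiber P (hX.measurable _),
    setLIntegral_comp_eq_tsum_fiber P (hX.measurable _)]
  simp_rw [hstep, avg, ← ENNReal.tsum_mul_left, ← ENNReal.tsum_mul_right]
  rw [ENNReal.tsum_comm]
  exact tsum_congr fun a => tsum_congr fun b => by ring

theorem IsWalk.measurableSet_past_prefix (hX : IsWalk P p X) (t k : ℕ) (x : ℕ → ℕ) :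
    MeasurableSet[hX.past (t + k)] {ω | ∀ i ≤ k, X (t + i) ω = x i} := by
  have hinter : {ω | ∀ i ≤ k, X (t + i) ω = x i} = ⋂ i ∈ Set.Iic k, X (t + i) ⁻¹' {x i} := by
    ext
    simp
  rw [hinter]
  exact MeasurableSet.biInter (Set.to_countable _) fun i hi =>
    hX.measurable_past (Nat.add_le_add_left hi t) (measurableSet_singleton _)

theorem IsWalk.restrict_shift (hX : IsWalk P p X) {t : ℕ} {C : Set Ω}
    (hC : MeasurableSet[hX.past t] C) : IsWalk (P.restrict C) p (fun i => X (t + i)) where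
  measurable k := hX.measurable _
  markov k x := by
    have hprefix := hX.measurableSet_past_prefix t
    rw [Measure.restrict_apply (hX.past.le _ _ (hprefix (k + 1) x)),
      Measure.restrict_apply (hX.past.le _ _ (hprefix k x)),
      ← hX.measure_step ((hprefix k x).inter (hX.past.mono (Nat.le_add_right t k) _ hC))
        (fun ω hω => hω.1 k le_rfl), Set.inter_right_comm]
    congr 2
    ext ω
    simp only [Nat.le_succ_iff, or_imp, forall_and, forall_eq, Set.mem_ofPred_eq,
      Set.mem_inter_iff, Set.mem_preimage, Set.mem_singleton_iff]
    rfl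

/-- The path moves only by steps `+2` and `-1`. -/
def Legal (x : ℕ → ℕ) : Prop := ∀ t, x (t + 1) = x t + 2 ∨ x (t + 1) + 1 = x t

theorem trans_eq_zero {a b : ℕ} (hab : ¬(b = a + 2 ∨ b + 1 = a)) : trans p a b = 0 := by
  rw [trans]
  split_ifs <;> first | rfl | omega

theorem IsWalk.ae_legal (hX : IsWalk P p X) : ∀ᵐ ω ∂P, Legal (traj X ω) := by
  refine ae_all_iff.2 fun t => ?_
  have hnull : ∀ a b : ℕ, ¬(b = a + 2 ∨ b + 1 = a) → ∀ᵐ ω ∂P, X t ω = a → X (t + 1) ω ≠ b := by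
    intro a b hab
    have hstep := hX.measure_step (hX.measurable_past (le_refl t) (measurableSet_singleton a))
      (fun ω hω => hω) b
    rw [trans_eq_zero hab, ENNReal.ofReal_zero, mul_zero] at hstep
    filter_upwards [measure_eq_zero_iff_ae_notMem.1 hstep] with ω hω ha hb using hω ⟨ha, hb⟩
  have hall : ∀ᵐ ω ∂P, ∀ a b : ℕ, ¬(b = a + 2 ∨ b + 1 = a) → X t ω = a → X (t + 1) ω ≠ b :=
    ae_all_iff.2 fun a => ae_all_iff.2 fun b => eventually_imp_distrib_left.2 (hnull a b)
  filter_upwards [hall] with ω hω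
  by_contra hne
  exact hω _ _ hne rfl rfl

end MarkovProperty

section LawUniqueness

theorem isPiSystem_prefix (E : Type*) :
    IsPiSystem {S : Set (ℕ → E) | ∃ (k : ℕ) (x : ℕ → E), S = {y | ∀ i ≤ k, y i = x i}} := by
  rintro _ ⟨k, x, rfl⟩ _ ⟨l, x', rfl⟩ ⟨y, hy, hy'⟩
  refine ⟨max k l, y, ?_⟩
  ext z
  constructor
  · rintro ⟨hz, hz'⟩ i hi
    rcases le_max_iff.1 hi with hk | hl
    · rw [hz i hk, hy i hk]
    · rw [hz' i hl, hy' i hl]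
  · exact fun hz => ⟨fun i hi => (hz i (le_max_of_le_left hi)).trans (hy i hi),
      fun i hi => (hz i (le_max_of_le_right hi)).trans (hy' i hi)⟩

theorem pi_eq_generateFrom_prefix (E : Type*) [MeasurableSpace E] [Countable E]
    [MeasurableSingletonClass E] :
    (MeasurableSpace.pi : MeasurableSpace (ℕ → E)) =
      .generateFrom {S | ∃ (k : ℕ) (x : ℕ → E), S = {y | ∀ i ≤ k, y i = x i}} := by
  apply le_antisymm
  · refine iSup_le fun n => ?_
    rw [← measurable_iff_comap_le]
    refine @measurable_to_countable' _ _ _ _ (_) _ fun a => ?_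
    have hunion : (fun y : ℕ → E => y n) ⁻¹' {a} =
        ⋃ z ∈ {z : Fin (n + 1) → E | z (Fin.last n) = a},
          {y : ℕ → E | ∀ i ≤ n, y i = if h : i < n + 1 then z ⟨i, h⟩ else a} := by
      ext y
      simp only [Set.mem_preimage, Set.mem_singleton_iff, Set.mem_iUnion, Set.mem_ofPred_eq,
        exists_prop]
      constructor
      · exact fun h => ⟨fun i => y i, by simpa using h, fun i hi => by rw [dif_pos (by omega)]⟩
      · rintro ⟨z, hz, h⟩
        rw [h n le_rfl, dif_pos (by omega), ← hz, Fin.last]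
    rw [hunion]
    exact MeasurableSet.biUnion (Set.to_countable _) fun z _ =>
      MeasurableSpace.measurableSet_generateFrom ⟨n, _, rfl⟩
  · refine MeasurableSpace.generateFrom_le ?_
    rintro _ ⟨k, x, rfl⟩
    have hinter : {y : ℕ → E | ∀ i ≤ k, y i = x i} = ⋂ i ∈ Set.Iic k, {y | y i = x i} := by
      ext
      simp
    rw [hinter]
    exact MeasurableSet.biInter (Set.to_countable _) fun i _ =>
      measurable_pi_apply i (measurableSet_singleton _)

variable {Ω Ω' : Type*} [MeasurableSpace Ω] [MeasurableSpace Ω'] {μ : Measure Ω} {ν : Measure Ω'}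
  {p : ℕ → ℝ} {X : ℕ → Ω → ℕ} {Y : ℕ → Ω' → ℕ}

theorem IsWalk.measure_prefix (hX : IsWalk μ p X) {a : ℕ} (ha : ∀ᵐ ω ∂μ, X 0 ω = a) (k : ℕ)
    (x : ℕ → ℕ) :
    μ {ω | ∀ i ≤ k, X i ω = x i} =
      μ Set.univ * ((if x 0 = a then 1 else 0) *
        ∏ i ∈ Finset.range k, ENNReal.ofReal (trans p (x i) (x (i + 1)))) := by
  induction k with
  | zero =>
    simp only [Nat.le_zero, forall_eq, Finset.range_zero, Finset.prod_empty, mul_one]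
    split_ifs with hx
    · rw [mul_one]
      refine measure_congr (eventuallyEq_univ.2 ?_)
      filter_upwards [ha] with ω hω using hω.trans hx.symm
    · rw [mul_zero]
      exact measure_mono_null (fun ω hω h => hx (Eq.trans (Eq.symm hω) h)) (ae_iff.1 ha)
  | succ k ih =>
    rw [hX.markov, ih, Finset.prod_range_succ]
    ring

theorem IsWalk.law_unique [IsFiniteMeasure μ] [IsFiniteMeasure ν] (hX : IsWalk μ p X)
    (hY : IsWalk ν p Y) {a : ℕ} (hXa : ∀ᵐ ω ∂μ, X 0 ω = a) (hYa : ∀ᵐ ω ∂ν, Y 0 ω = a)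
    {S : Set (ℕ → ℕ)} (hS : MeasurableSet S) :
    ν Set.univ * μ (traj X ⁻¹' S) = μ Set.univ * ν (traj Y ⁻¹' S) := by
  have hlaw : ν Set.univ • μ.map (traj X) = μ Set.univ • ν.map (traj Y) := by
    have : IsFiniteMeasure (ν Set.univ • μ.map (traj X)) :=
      Measure.smul_finite _ (measure_ne_top _ _)
    refine ext_of_generate_finite _ (pi_eq_generateFrom_prefix ℕ) (isPiSystem_prefix ℕ) ?_ ?_
    · rintro S ⟨k, x, rfl⟩
      have hS : MeasurableSet {y : ℕ → ℕ | ∀ i ≤ k, y i = x i} := by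
        rw [pi_eq_generateFrom_prefix]
        exact MeasurableSpace.measurableSet_generateFrom ⟨k, x, rfl⟩
      rw [Measure.smul_apply, Measure.smul_apply, Measure.map_apply hX.measurable_traj hS,
        Measure.map_apply hY.measurable_traj hS]
      change _ * μ {ω | ∀ i ≤ k, X i ω = x i} = _ * ν {ω | ∀ i ≤ k, Y i ω = x i}
      rw [hX.measure_prefix hXa, hY.measure_prefix hYa]
      ring
    · rw [Measure.smul_apply, Measure.smul_apply, Measure.map_apply hX.measurable_traj .univ,
        Measure.map_apply hY.measurable_traj .univ]
      exact mul_comm _ _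
  have hlawS := congrArg (fun m => m S) hlaw
  rwa [Measure.smul_apply, Measure.smul_apply, Measure.map_apply hX.measurable_traj hS,
    Measure.map_apply hY.measurable_traj hS] at hlawS

end LawUniqueness

section ExitEvents

variable {Ω : Type*} (X : ℕ → Ω → ℕ) (B E : Set ℕ)

/-- The event that the walk is in `B` up to time `t`. -/
def stay (t : ℕ) : Set Ω := {ω | ∀ s ≤ t, X s ω ∈ B}

/-- The event that the walk is in `B` up to time `t` and in `E` at time `t + 1`; for `E` disjoint
from `B` this says that the walk leaves `B` at time `t + 1`, into `E`. -/
def exitAt (t : ℕ) : Set Ω := stay X B t ∩ X (t + 1) ⁻¹' E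

/-- The paths which stay in `B` up to some time `t`, are in `E` at time `t + 1`, and from time
`t + 1` on form a path in `S`. -/
def exitThen (S : Set (ℕ → ℕ)) : Set (ℕ → ℕ) :=
  {x | ∃ t, (∀ s ≤ t, x s ∈ B) ∧ x (t + 1) ∈ E ∧ (fun i => x (t + 1 + i)) ∈ S}

/-- The paths which stay in `B` until they step into `E`. -/
abbrev exitInto : Set (ℕ → ℕ) := exitThen B E Set.univ

theorem stay_zero : stay X B 0 = X 0 ⁻¹' B := by
  ext
  simp [stay]

theorem stay_succ (t : ℕ) : stay X B (t + 1) = stay X B t ∩ X (t + 1) ⁻¹' B := by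
  ext ω
  simp only [stay, Nat.le_succ_iff, or_imp, forall_and, forall_eq, Set.mem_ofPred_eq,
    Set.mem_inter_iff, Set.mem_preimage]

theorem antitone_stay : Antitone (stay X B) :=
  fun _ _ hst _ hω i hi => hω i (hi.trans hst)

variable {B E}

theorem pairwise_disjoint_exitAt (hBE : Disjoint B E) :
    Pairwise (Function.onFun Disjoint (exitAt X B E)) := by
  refine (pairwise_disjoint_on _).2 fun s t hst => Set.disjoint_left.2 ?_
  rintro ω ⟨-, hexit⟩ ⟨hstay, -⟩
  exact hBE.notMem_of_mem_right hexit (hstay (s + 1) hst)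

theorem traj_preimage_exitThen (B E : Set ℕ) (S : Set (ℕ → ℕ)) :
    traj X ⁻¹' exitThen B E S =
      ⋃ t, exitAt X B E t ∩ traj (fun i => X (t + 1 + i)) ⁻¹' S := by
  ext ω
  simp only [exitThen, exitAt, stay, Set.mem_preimage, Set.mem_iUnion, Set.mem_inter_iff,
    Set.mem_ofPred_eq, and_assoc]

variable {X} [MeasurableSpace Ω] {P : Measure Ω} {p : ℕ → ℝ}

theorem IsWalk.measurableSet_past_stay (hX : IsWalk P p X) (B : Set ℕ) (t : ℕ) :
    MeasurableSet[hX.past t] (stay X B t) := by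
  have hinter : stay X B t = ⋂ s ∈ Set.Iic t, X s ⁻¹' B := by
    ext
    simp [stay]
  rw [hinter]
  exact MeasurableSet.biInter (Set.to_countable _) fun s hs => hX.measurable_past hs .of_discrete

theorem IsWalk.measurableSet_past_exitAt (hX : IsWalk P p X) (B E : Set ℕ) (t : ℕ) :
    MeasurableSet[hX.past (t + 1)] (exitAt X B E t) :=
  (hX.past.mono t.le_succ _ (hX.measurableSet_past_stay B t)).inter
    (hX.measurable_past le_rfl .of_discrete)

theorem IsWalk.measurableSet_stay (hX : IsWalk P p X) (B : Set ℕ) (t : ℕ) :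
    MeasurableSet (stay X B t) :=
  hX.past.le _ _ (hX.measurableSet_past_stay B t)

theorem IsWalk.measurableSet_exitAt (hX : IsWalk P p X) (B E : Set ℕ) (t : ℕ) :
    MeasurableSet (exitAt X B E t) :=
  hX.past.le _ _ (hX.measurableSet_past_exitAt B E t)

theorem IsWalk.isWalk_restrict_exitAt (hX : IsWalk P p X) (B E : Set ℕ) (t : ℕ) :
    IsWalk (P.restrict (exitAt X B E t)) p (fun i => X (t + 1 + i)) :=
  hX.restrict_shift (hX.measurableSet_past_exitAt B E t)

theorem IsWalk.measure_exitThen (hX : IsWalk P p X) (hBE : Disjoint B E) {S : Set (ℕ → ℕ)}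
    (hS : MeasurableSet S) :
    P (traj X ⁻¹' exitThen B E S) =
      ∑' t, P.restrict (exitAt X B E t) (traj (fun i => X (t + 1 + i)) ⁻¹' S) := by
  have hshift : ∀ t, MeasurableSet (traj (fun i => X (t + 1 + i)) ⁻¹' S) := fun t =>
    (hX.isWalk_restrict_exitAt B E t).measurable_traj hS
  rw [traj_preimage_exitThen, measure_iUnion]
  · refine tsum_congr fun t => ?_
    rw [Measure.restrict_apply (hshift t), Set.inter_comm]
  · exact fun s t hst => (pairwise_disjoint_exitAt X hBE hst).mono Set.inter_subset_left
      Set.inter_subset_left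
  · exact fun t => (hX.measurableSet_exitAt B E t).inter (hshift t)

theorem IsWalk.measure_exitInto (hX : IsWalk P p X) (hBE : Disjoint B E) :
    P (traj X ⁻¹' exitInto B E) = ∑' t, P (exitAt X B E t) := by
  simp only [hX.measure_exitThen hBE .univ, Set.preimage_univ, Measure.restrict_apply_univ]

end ExitEvents

section OptionalStopping

variable {Ω : Type*} [MeasurableSpace Ω] {P : Measure Ω} {p : ℕ → ℝ} {X : ℕ → Ω → ℕ}
  {B E : Set ℕ} {f : ℕ → ℝ≥0∞} {c : ℝ≥0∞}

theorem IsWalk.setLIntegral_stay_add_le (hX : IsWalk P p X) (hBE : Disjoint B E)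
    (hf : ∀ x ∈ B, avg p f x ≤ f x) (hc : ∀ y ∈ E, c ≤ f y) (t : ℕ) :
    ∫⁻ ω in stay X B (t + 1), f (X (t + 1) ω) ∂P + c * P (exitAt X B E t) ≤
      ∫⁻ ω in stay X B t, f (X t ω) ∂P := by
  have hdisj : Disjoint (stay X B (t + 1)) (exitAt X B E t) :=
    Set.disjoint_left.2 fun ω hω hexit => hBE.notMem_of_mem_right hexit.2 (hω (t + 1) le_rfl)
  have hsub : stay X B (t + 1) ∪ exitAt X B E t ⊆ stay X B t :=
    Set.union_subset (antitone_stay X B t.le_succ) Set.inter_subset_left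
  calc ∫⁻ ω in stay X B (t + 1), f (X (t + 1) ω) ∂P + c * P (exitAt X B E t)
      ≤ ∫⁻ ω in stay X B (t + 1), f (X (t + 1) ω) ∂P +
          ∫⁻ ω in exitAt X B E t, f (X (t + 1) ω) ∂P := by
        rw [← setLIntegral_const]
        exact add_le_add le_rfl
          (setLIntegral_mono' (hX.measurableSet_exitAt B E t) fun ω hω => hc _ hω.2)
    _ = ∫⁻ ω in stay X B (t + 1) ∪ exitAt X B E t, f (X (t + 1) ω) ∂P :=
        (lintegral_union (hX.measurableSet_exitAt B E t) hdisj).symm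
    _ ≤ ∫⁻ ω in stay X B t, f (X (t + 1) ω) ∂P := lintegral_mono_set hsub
    _ = ∫⁻ ω in stay X B t, avg p f (X t ω) ∂P :=
        hX.setLIntegral_step (hX.measurableSet_past_stay B t) f
    _ ≤ ∫⁻ ω in stay X B t, f (X t ω) ∂P :=
        setLIntegral_mono' (hX.measurableSet_stay B t) fun ω hω => hf _ (hω t le_rfl)

theorem IsWalk.mul_measure_exitInto_le (hX : IsWalk P p X) (hBE : Disjoint B E)
    (hf : ∀ x ∈ B, avg p f x ≤ f x) (hc : ∀ y ∈ E, c ≤ f y) :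
    c * P (traj X ⁻¹' exitInto B E) ≤ ∫⁻ ω in X 0 ⁻¹' B, f (X 0 ω) ∂P := by
  have hsum : ∀ T, ∫⁻ ω in stay X B T, f (X T ω) ∂P +
      ∑ t ∈ Finset.range T, c * P (exitAt X B E t) ≤ ∫⁻ ω in X 0 ⁻¹' B, f (X 0 ω) ∂P := by
    intro T
    induction T with
    | zero => simp [stay_zero]
    | succ T ih =>
      refine le_trans ?_ ih
      rw [Finset.sum_range_succ_comm, ← add_assoc]
      gcongr
      exact hX.setLIntegral_stay_add_le hBE hf hc T
  rw [hX.measure_exitInto hBE, ← ENNReal.tsum_mul_left, ENNReal.tsum_eq_iSup_nat]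
  exact iSup_le fun T => le_add_self.trans (hsum T)

theorem IsWalk.setLIntegral_stay_le_add (hX : IsWalk P p X) (hf : ∀ x ∈ B, f x ≤ avg p f x)
    (hexit : ∀ x ∈ B, ∀ y ∉ B, y = x + 2 ∨ y + 1 = x → y ∈ E ∧ f y ≤ c ∨ f y = 0) (t : ℕ) :
    ∫⁻ ω in stay X B t, f (X t ω) ∂P ≤
      ∫⁻ ω in stay X B (t + 1), f (X (t + 1) ω) ∂P + c * P (exitAt X B E t) := by
  have hmeas : MeasurableSet (X (t + 1) ⁻¹' E) := hX.measurable _ .of_discrete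
  have hmeasB : MeasurableSet (X (t + 1) ⁻¹' B) := hX.measurable _ .of_discrete
  calc ∫⁻ ω in stay X B t, f (X t ω) ∂P
      ≤ ∫⁻ ω in stay X B t, avg p f (X t ω) ∂P :=
        setLIntegral_mono' (hX.measurableSet_stay B t) fun ω hω => hf _ (hω t le_rfl)
    _ = ∫⁻ ω in stay X B t, f (X (t + 1) ω) ∂P :=
        (hX.setLIntegral_step (hX.measurableSet_past_stay B t) f).symm
    _ ≤ ∫⁻ ω in stay X B t, ((X (t + 1) ⁻¹' B).indicator (fun ω => f (X (t + 1) ω)) ω +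
          (X (t + 1) ⁻¹' E).indicator (fun _ => c) ω) ∂P := by
        refine setLIntegral_mono_ae' (hX.measurableSet_stay B t) ?_
        filter_upwards [hX.ae_legal] with ω hlegal hω
        by_cases hB : X (t + 1) ω ∈ B
        · rw [Set.indicator_of_mem (s := X (t + 1) ⁻¹' B) hB]
          exact le_self_add
        · rcases hexit _ (hω t le_rfl) _ hB (hlegal t) with ⟨hE, hle⟩ | hzero
          · rw [Set.indicator_of_mem (s := X (t + 1) ⁻¹' E) hE]
            exact hle.trans le_add_self
          · rw [hzero]
            exact zero_le
    _ = ∫⁻ ω in stay X B (t + 1), f (X (t + 1) ω) ∂P + c * P (exitAt X B E t) := by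
        rw [lintegral_add_right _ (measurable_const.indicator hmeas),
          setLIntegral_indicator hmeasB, setLIntegral_indicator hmeas, setLIntegral_const,
          stay_succ, exitAt, Set.inter_comm, Set.inter_comm (X (t + 1) ⁻¹' E)]

theorem IsWalk.tendsto_measure_stay [IsFiniteMeasure P] (hX : IsWalk P p X)
    (hstay : P {ω | ∀ t, X t ω ∈ B} = 0) : Tendsto (fun t => P (stay X B t)) atTop (𝓝 0) := by
  have hinter : ⋂ t, stay X B t ⊆ {ω | ∀ t, X t ω ∈ B} :=
    fun ω hω t => Set.mem_iInter.1 hω t t le_rfl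
  rw [← measure_mono_null hinter hstay]
  exact tendsto_measure_iInter_atTop (fun t => (hX.measurableSet_stay B t).nullMeasurableSet)
    (antitone_stay X B) ⟨0, measure_ne_top _ _⟩

theorem IsWalk.setLIntegral_le_mul_measure_exitInto [IsFiniteMeasure P] (hX : IsWalk P p X)
    (hBE : Disjoint B E) (hf : ∀ x ∈ B, f x ≤ avg p f x)
    (hexit : ∀ x ∈ B, ∀ y ∉ B, y = x + 2 ∨ y + 1 = x → y ∈ E ∧ f y ≤ c ∨ f y = 0)
    (hbdd : ∀ x ∈ B, f x ≤ c) (hc : c ≠ ∞) (hstay : P {ω | ∀ t, X t ω ∈ B} = 0) :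
    ∫⁻ ω in X 0 ⁻¹' B, f (X 0 ω) ∂P ≤ c * P (traj X ⁻¹' exitInto B E) := by
  have hsum : ∀ T, ∫⁻ ω in X 0 ⁻¹' B, f (X 0 ω) ∂P ≤
      ∫⁻ ω in stay X B T, f (X T ω) ∂P + ∑ t ∈ Finset.range T, c * P (exitAt X B E t) := by
    intro T
    induction T with
    | zero => simp [stay_zero]
    | succ T ih =>
      refine ih.trans ?_
      rw [Finset.sum_range_succ_comm, ← add_assoc]
      gcongr
      exact hX.setLIntegral_stay_le_add hf hexit T
  have hle : ∀ T, ∫⁻ ω in X 0 ⁻¹' B, f (X 0 ω) ∂P ≤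
      c * P (stay X B T) + c * P (traj X ⁻¹' exitInto B E) := by
    intro T
    refine (hsum T).trans (add_le_add ?_ ?_)
    · rw [← setLIntegral_const]
      exact setLIntegral_mono' (hX.measurableSet_stay B T) fun ω hω => hbdd _ (hω T le_rfl)
    · rw [hX.measure_exitInto hBE, ← ENNReal.tsum_mul_left]
      exact ENNReal.sum_le_tsum _
  have hlim := (ENNReal.Tendsto.const_mul (hX.tendsto_measure_stay hstay) (.inr hc)).add_const
    (c * P (traj X ⁻¹' exitInto B E))
  rw [mul_zero, zero_add] at hlim
  exact ge_of_tendsto' hlim hle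

theorem IsWalk.measure_forall_mem_eq_zero [IsFiniteMeasure P] (hX : IsWalk P p X)
    (hf : ∀ x ∈ B, avg p f x + 1 ≤ f x) (hbdd : ∀ x ∈ B, f x ≤ c) (hc : c ≠ ∞) :
    P {ω | ∀ t, X t ω ∈ B} = 0 := by
  set g := P {ω | ∀ t, X t ω ∈ B}
  have hstep : ∀ t, ∫⁻ ω in stay X B (t + 1), f (X (t + 1) ω) ∂P + g ≤
      ∫⁻ ω in stay X B t, f (X t ω) ∂P := by
    intro t
    calc ∫⁻ ω in stay X B (t + 1), f (X (t + 1) ω) ∂P + g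
        ≤ ∫⁻ ω in stay X B t, f (X (t + 1) ω) ∂P + ∫⁻ _ in stay X B t, 1 ∂P := by
          rw [setLIntegral_one]
          gcongr
          · exact antitone_stay X B t.le_succ
          · exact measure_mono fun ω hω s _ => hω s
      _ = ∫⁻ ω in stay X B t, (avg p f (X t ω) + 1) ∂P := by
          rw [hX.setLIntegral_step (hX.measurableSet_past_stay B t) f,
            lintegral_add_right _ measurable_const]
      _ ≤ ∫⁻ ω in stay X B t, f (X t ω) ∂P :=
          setLIntegral_mono' (hX.measurableSet_stay B t) fun ω hω => hf _ (hω t le_rfl)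
  have hsum : ∀ t : ℕ, ∫⁻ ω in stay X B t, f (X t ω) ∂P + t * g ≤
      ∫⁻ ω in stay X B 0, f (X 0 ω) ∂P := by
    intro t
    induction t with
    | zero => simp
    | succ t ih =>
      rw [Nat.cast_succ, add_one_mul, add_comm _ g, ← add_assoc]
      exact (add_le_add_left (hstep t) _).trans ih
  have hfinite : ∫⁻ ω in stay X B 0, f (X 0 ω) ∂P ≠ ∞ := by
    refine ne_top_of_le_ne_top (ENNReal.mul_ne_top hc (measure_ne_top P (stay X B 0))) ?_
    rw [← setLIntegral_const]
    exact setLIntegral_mono' (hX.measurableSet_stay B 0) fun ω hω => hbdd _ (hω 0 le_rfl)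
  by_contra hpos
  obtain ⟨N, hN⟩ := ENNReal.exists_nat_mul_gt hpos hfinite
  exact absurd (le_add_self.trans (hsum N)) (not_le.2 hN)

end OptionalStopping

section Unbounded

variable {Ω : Type*} [MeasurableSpace Ω] {P : Measure Ω} {p : ℕ → ℝ} {X : ℕ → Ω → ℕ}

/-- A nonnegative function on `[0, n + 2]` which, for a large base `b`, decreases on average by at
least `1` in every step of the walk from `[0, n)`. -/
noncomputable def lyapunov (b : ℝ) (n x : ℕ) : ℝ≥0∞ := ENNReal.ofReal (b ^ (n + 2) - b ^ x)

theorem avg_lyapunov_add_one_le {b : ℝ} (hb : 2 ≤ b) {n x : ℕ} (hx : x < n)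
    (hp : 1 ≤ x → p x ∈ Set.Icc (2 / b) 1) :
    avg p (lyapunov b n) x + 1 ≤ lyapunov b n x := by
  have hb_one : 1 ≤ b := by linarith
  have hpow : ∀ y ≤ n + 2, 0 ≤ b ^ (n + 2) - b ^ y := fun y hy =>
    sub_nonneg.2 (pow_le_pow_right₀ hb_one hy)
  rcases x with _ | y
  · rw [avg_zero, lyapunov, lyapunov, ← ENNReal.ofReal_one,
      ← ENNReal.ofReal_add (hpow 2 (by omega)) zero_le_one]
    exact ENNReal.ofReal_le_ofReal (by nlinarith)
  · obtain ⟨hp_lower, hp_upper⟩ := hp (by omega)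
    have hp_nonneg : 0 ≤ p (y + 1) := le_trans (by positivity) hp_lower
    have hdrift : b ^ (y + 1) + 1 ≤ p (y + 1) * b ^ (y + 3) := by
      have hpb : 2 ≤ p (y + 1) * b := (div_le_iff₀ (by linarith)).1 hp_lower
      have hy : 1 ≤ b ^ (y + 1) := one_le_pow₀ hb_one
      calc b ^ (y + 1) + 1 ≤ 2 * b ^ (y + 1) := by linarith
        _ ≤ 2 * b ^ (y + 2) := by gcongr; omega
        _ ≤ p (y + 1) * b * b ^ (y + 2) := by gcongr
        _ = p (y + 1) * b ^ (y + 3) := by ring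
    unfold lyapunov
    rw [avg_succ_ofReal ⟨hp_nonneg, hp_upper⟩ (hpow y (by omega)) (hpow (y + 3) (by omega)),
      ← ENNReal.ofReal_one, ← ENNReal.ofReal_add (add_nonneg
        (mul_nonneg hp_nonneg (hpow (y + 3) (by omega)))
        (mul_nonneg (by linarith) (hpow y (by omega)))) zero_le_one]
    refine ENNReal.ofReal_le_ofReal ?_
    have hlast : 0 ≤ (1 - p (y + 1)) * b ^ y := mul_nonneg (by linarith) (by positivity)
    linarith

theorem IsWalk.measure_forall_lt_eq_zero [IsFiniteMeasure P] (hX : IsWalk P p X)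
    (hp : ∀ n, 1 ≤ n → p n ∈ Set.Ioc 0 1) (n : ℕ) : P {ω | ∀ t, X t ω < n} = 0 := by
  obtain ⟨ε, hε, hε_one, hεp⟩ : ∃ ε > 0, ε ≤ 1 ∧ ∀ x ∈ Finset.Icc 1 n, ε ≤ p x := by
    rcases (Finset.Icc 1 n).eq_empty_or_nonempty with hempty | hne
    · exact ⟨1, one_pos, le_rfl, by simp [hempty]⟩
    · obtain ⟨x, hx, hmin⟩ := Finset.exists_min_image _ p hne
      have hpx := hp x (Finset.mem_Icc.1 hx).1
      exact ⟨p x, hpx.1, hpx.2, hmin⟩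
  have hb : 2 ≤ 2 / ε := (le_div_iff₀ hε).2 (by linarith)
  refine hX.measure_forall_mem_eq_zero (B := Set.Iio n) (f := lyapunov (2 / ε) n)
    (c := ENNReal.ofReal ((2 / ε) ^ (n + 2))) (fun x hx => ?_) (fun x _ => ?_)
    ENNReal.ofReal_ne_top
  · refine avg_lyapunov_add_one_le hb hx fun hx_one => ⟨?_, (hp x hx_one).2⟩
    rw [div_div_cancel₀ two_ne_zero]
    exact hεp x (Finset.mem_Icc.2 ⟨hx_one, le_of_lt hx⟩)
  · exact ENNReal.ofReal_le_ofReal (sub_le_self _ (by positivity))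

theorem IsWalk.ae_unbounded [IsFiniteMeasure P] (hX : IsWalk P p X)
    (hp : ∀ n, 1 ≤ n → p n ∈ Set.Ioc 0 1) : ∀ᵐ ω ∂P, ∀ n, ∃ t, n ≤ X t ω := by
  refine ae_all_iff.2 fun n => ?_
  filter_upwards [measure_eq_zero_iff_ae_notMem.1 (hX.measure_forall_lt_eq_zero hp n)] with ω hω
  simpa using hω

end Unbounded

section GamblersRuin

theorem Legal.lt_of_ne {x : ℕ → ℕ} (hx : Legal x) {m s : ℕ} (hs : m < x s) {t : ℕ} (hst : s ≤ t)
    (hne : ∀ i, s ≤ i → i ≤ t → x i ≠ m) : m < x t := by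
  induction t, hst using Nat.le_induction with
  | base => exact hs
  | succ t ht ih =>
    have hlt := ih fun i hi hit => hne i hi (by omega)
    have hne' := hne (t + 1) (by omega) le_rfl
    have hstep := hx t
    omega

theorem exists_first_passage {x : ℕ → ℕ} {n : ℕ} (h0 : x 0 < n) {s : ℕ} (hs : n ≤ x s) :
    ∃ t < s, (∀ i ≤ t, x i < n) ∧ n ≤ x (t + 1) := by
  classical
  have hex : ∃ s, n ≤ x s := ⟨s, hs⟩
  obtain ⟨t, ht⟩ : ∃ t, Nat.find hex = t + 1 := Nat.exists_eq_succ_of_ne_zero fun hzero => by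
    have hspec := Nat.find_spec hex
    rw [hzero] at hspec
    omega
  refine ⟨t, ?_, fun i hi => not_le.1 (Nat.find_min hex (by omega)), ht ▸ Nat.find_spec hex⟩
  have hle := Nat.find_min' hex hs
  omega

/-- The paths that never visit `k`. -/
def avoid (k : ℕ) : Set (ℕ → ℕ) := {x | ∀ t, x t ≠ k}

/-- The paths that leave the interval `(m, n)` upwards. -/
abbrev climb (m n : ℕ) : Set (ℕ → ℕ) := exitInto (Set.Ioo m n) (Set.Ici n)

theorem disjoint_Ioo_Ici (m n : ℕ) : Disjoint (Set.Ioo m n) (Set.Ici n) :=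
  Set.disjoint_left.2 fun _ hx hx' => absurd hx.2 (not_lt.2 hx')

theorem measurableSet_avoid (k : ℕ) : MeasurableSet (avoid k) := by
  have hinter : avoid k = ⋂ t, (fun x : ℕ → ℕ => x t) ⁻¹' {k}ᶜ := by
    ext
    simp [avoid]
  rw [hinter]
  exact MeasurableSet.iInter fun t => measurable_pi_apply t .of_discrete

theorem measurableSet_exitThen (B E : Set ℕ) {S : Set (ℕ → ℕ)} (hS : MeasurableSet S) :
    MeasurableSet (exitThen B E S) := by
  have hunion : exitThen B E S = ⋃ t, (⋂ s ∈ Set.Iic t, (fun x : ℕ → ℕ => x s) ⁻¹' B) ∩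
      ((fun x => x (t + 1)) ⁻¹' E ∩ (fun x i => x (t + 1 + i)) ⁻¹' S) := by
    ext
    simp [exitThen]
  rw [hunion]
  exact MeasurableSet.iUnion fun t => (MeasurableSet.biInter (Set.to_countable _)
    fun s _ => measurable_pi_apply s .of_discrete).inter
    ((measurable_pi_apply (t + 1) .of_discrete).inter
      (measurable_pi_lambda _ (fun i => measurable_pi_apply (t + 1 + i)) hS))

theorem mem_climb_of_mem_avoid {x : ℕ → ℕ} (hx : Legal x) (hunb : ∀ n, ∃ t, n ≤ x t) {m n : ℕ}
    (h0 : x 0 ∈ Set.Ioo m n) (hm : x ∈ avoid m) : x ∈ climb m n := by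
  obtain ⟨s, hs⟩ := hunb n
  obtain ⟨t, -, hbelow, hpass⟩ := exists_first_passage h0.2 hs
  exact ⟨t, fun i hi => ⟨hx.lt_of_ne h0.1 i.zero_le fun i _ _ => hm i, hbelow i hi⟩, hpass,
    trivial⟩

theorem mem_climb_of_le {x : ℕ → ℕ} {m n n' : ℕ} (h0 : x 0 < n) (hnn' : n ≤ n')
    (hx : x ∈ climb m n') : x ∈ climb m n := by
  obtain ⟨t, hstay, hreach, -⟩ := hx
  obtain ⟨s, hst, hbelow, hpass⟩ := exists_first_passage h0 (hnn'.trans hreach)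
  exact ⟨s, fun i hi => ⟨(hstay i (by omega)).1, hbelow i hi⟩, hpass, trivial⟩

theorem mem_avoid_of_forall_mem_climb {x : ℕ → ℕ} {m : ℕ} (hx : ∀ n, x ∈ climb m (m + 2 + n)) :
    x ∈ avoid m := by
  intro s hs
  obtain ⟨t, hstay, hreach, -⟩ := hx (∑ i ∈ Finset.range (s + 1), x i)
  have hts : t < s := by
    by_contra hst
    have hmem := hstay s (not_lt.1 hst)
    exact hmem.1.ne' hs
  have hsum : x (t + 1) ≤ ∑ i ∈ Finset.range (s + 1), x i :=
    Finset.single_le_sum (fun _ _ => Nat.zero_le _) (Finset.mem_range.2 (by omega))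
  have hreach' : m + 2 + ∑ i ∈ Finset.range (s + 1), x i ≤ x (t + 1) := hreach
  omega

variable {Ω : Type*} [MeasurableSpace Ω] {P : Measure Ω} {p ξ : ℕ → ℝ} {X : ℕ → Ω → ℕ} {m n : ℕ}

theorem IsTailSolution.avg_DFin (hξ : IsTailSolution p ξ) {x : ℕ} (hx : m < x) :
    avg p (fun y => ENNReal.ofReal (DFin ξ m y)) x = ENNReal.ofReal (DFin ξ m x) := by
  obtain ⟨y, rfl⟩ := Nat.exists_eq_add_of_lt hx
  rw [avg_succ_ofReal (Set.Ioo_subset_Icc_self (hξ.mem_Ioo (by omega))) (hξ.DFin_nonneg _ _)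
    (hξ.DFin_nonneg _ _), hξ.DFin_harmonic (by omega)]

theorem setLIntegral_DFin_eq_of_start (ha : ∀ᵐ ω ∂P, X 0 ω = m + 1) (hmn : m + 1 < n) :
    ∫⁻ ω in X 0 ⁻¹' Set.Ioo m n, ENNReal.ofReal (DFin ξ m (X 0 ω)) ∂P = P Set.univ := by
  have hmem : X 0 ⁻¹' Set.Ioo m n =ᵐ[P] Set.univ := eventuallyEq_univ.2 <| by
    filter_upwards [ha] with ω hω
    rw [Set.mem_preimage, hω]
    exact ⟨m.lt_succ_self, hmn⟩
  have hone : ∀ᵐ ω ∂P, ENNReal.ofReal (DFin ξ m (X 0 ω)) = 1 := by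
    filter_upwards [ha] with ω hω
    rw [hω, DFin_self_succ, ENNReal.ofReal_one]
  rw [setLIntegral_congr hmem, setLIntegral_univ, lintegral_congr_ae hone, lintegral_one]

theorem IsWalk.mul_measure_climb_le (hX : IsWalk P p X) (hξ : IsTailSolution p ξ)
    (ha : ∀ᵐ ω ∂P, X 0 ω = m + 1) (hmn : m + 1 < n) :
    ENNReal.ofReal (DFin ξ m n) * P (traj X ⁻¹' climb m n) ≤ P Set.univ := by
  rw [← setLIntegral_DFin_eq_of_start (ξ := ξ) ha hmn]
  exact hX.mul_measure_exitInto_le (disjoint_Ioo_Ici m n) (fun x hx => (hξ.avg_DFin hx.1).le)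
    fun y hy => ENNReal.ofReal_le_ofReal (hξ.DFin_mono m hy)

theorem IsWalk.le_mul_measure_climb [IsFiniteMeasure P] (hX : IsWalk P p X)
    (hξ : IsTailSolution p ξ) (ha : ∀ᵐ ω ∂P, X 0 ω = m + 1) (hmn : m + 1 < n) :
    P Set.univ ≤ ENNReal.ofReal (DFin ξ m (n + 1)) * P (traj X ⁻¹' climb m n) := by
  have hle : ∀ y ≤ n + 1, ENNReal.ofReal (DFin ξ m y) ≤ ENNReal.ofReal (DFin ξ m (n + 1)) :=
    fun y hy => ENNReal.ofReal_le_ofReal (hξ.DFin_mono m hy)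
  rw [← setLIntegral_DFin_eq_of_start (ξ := ξ) ha hmn]
  refine hX.setLIntegral_le_mul_measure_exitInto (disjoint_Ioo_Ici m n)
    (fun x hx => (hξ.avg_DFin hx.1).ge) (fun x hx y hy hstep => ?_)
    (fun x hx => hle x (hx.2.le.trans n.le_succ)) ENNReal.ofReal_ne_top ?_
  · rcases le_or_gt n y with hny | hyn
    · exact .inl ⟨hny, hle y (by have := hx.2; omega)⟩
    · exact .inr (by rw [DFin_of_le ξ (not_lt.1 fun hmy => hy ⟨hmy, hyn⟩), ENNReal.ofReal_zero])
  · exact measure_mono_null (fun ω hω t => (hω t).2)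
      (hX.measure_forall_lt_eq_zero (fun i hi => Set.Ioo_subset_Ioc_self (hξ.mem_Ioo hi)) n)

theorem IsTailSolution.ae_unbounded [IsFiniteMeasure P] (hξ : IsTailSolution p ξ)
    (hX : IsWalk P p X) : ∀ᵐ ω ∂P, ∀ n, ∃ t, n ≤ X t ω :=
  hX.ae_unbounded fun _ hi => Set.Ioo_subset_Ioc_self (hξ.mem_Ioo hi)

theorem IsWalk.mul_measure_avoid_le [IsFiniteMeasure P] (hX : IsWalk P p X)
    (hξ : IsTailSolution p ξ) (ha : ∀ᵐ ω ∂P, X 0 ω = m + 1) :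
    D ξ m * P (traj X ⁻¹' avoid m) ≤ P Set.univ := by
  rw [D, ENNReal.iSup_mul]
  refine iSup_le fun n => le_trans ?_ (hX.mul_measure_climb_le hξ ha (n := n + m + 2) (by omega))
  refine mul_le_mul' (ENNReal.ofReal_le_ofReal (hξ.DFin_mono m (by omega))) (measure_mono_ae ?_)
  filter_upwards [hX.ae_legal, hξ.ae_unbounded hX, ha] with ω hlegal hunb h0 hω
  refine mem_climb_of_mem_avoid hlegal hunb ?_ hω
  rw [traj, h0]
  exact ⟨m.lt_succ_self, by omega⟩

theorem IsWalk.le_mul_measure_avoid [IsFiniteMeasure P] (hX : IsWalk P p X)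
    (hξ : IsTailSolution p ξ) (ha : ∀ᵐ ω ∂P, X 0 ω = m + 1) (hD : D ξ m ≠ ∞) :
    P Set.univ ≤ D ξ m * P (traj X ⁻¹' avoid m) := by
  let reach : ℕ → Set Ω := fun n => X 0 ⁻¹' {m + 1} ∩ traj X ⁻¹' climb m (m + 2 + n)
  have hreach : ∀ n, P Set.univ ≤ D ξ m * P (reach n) := fun n =>
    (hX.le_mul_measure_climb hξ ha (n := m + 2 + n) (by omega)).trans (mul_le_mul' (DFin_le_D ξ m _)
      (measure_mono_ae (by filter_upwards [ha] with ω h0 hω using ⟨h0, hω⟩)))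
  have hmeas : ∀ n, MeasurableSet (reach n) := fun n => (hX.measurable 0 .of_discrete).inter
    (hX.measurable_traj (measurableSet_exitThen _ _ .univ))
  have hanti : Antitone reach := fun i j hij ω hω => by
    have h0 : X 0 ω = m + 1 := hω.1
    exact ⟨h0, mem_climb_of_le (by rw [traj, h0]; omega) (by omega) hω.2⟩
  have hlim := ENNReal.Tendsto.const_mul (a := D ξ m) (tendsto_measure_iInter_atTop (μ := P)
    (fun n => (hmeas n).nullMeasurableSet) hanti ⟨0, measure_ne_top _ _⟩) (.inr hD)
  refine (ge_of_tendsto' hlim hreach).trans (mul_le_mul' le_rfl (measure_mono fun ω hω => ?_))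
  exact mem_avoid_of_forall_mem_climb fun n => (Set.mem_iInter.1 hω n).2

theorem IsWalk.measure_avoid [IsFiniteMeasure P] (hX : IsWalk P p X) (hξ : IsTailSolution p ξ)
    (ha : ∀ᵐ ω ∂P, X 0 ω = m + 1) : P (traj X ⁻¹' avoid m) = P Set.univ / D ξ m := by
  have hD_pos : D ξ m ≠ 0 := (zero_lt_one.trans_le (one_le_D ξ m)).ne'
  apply le_antisymm
  · rw [ENNReal.le_div_iff_mul_le (.inl hD_pos) (.inr (measure_ne_top _ _)), mul_comm]
    exact hX.mul_measure_avoid_le hξ ha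
  · by_cases hD : D ξ m = ∞
    · rw [hD, ENNReal.div_top]
      exact zero_le
    · rw [ENNReal.div_le_iff hD_pos hD, mul_comm]
      exact hX.le_mul_measure_avoid hξ ha hD

end GamblersRuin

section Jumps

/-- The paths which stay in `B ∩ [0, k)` until they jump over `k`, and from that jump on form a
path in `S`. -/
abbrev jumpThen (B : Set ℕ) (k : ℕ) (S : Set (ℕ → ℕ)) : Set (ℕ → ℕ) :=
  exitThen (B ∩ Set.Iio k) {k + 1} S

/-- The paths which stay in `B ∩ [0, k)` until they jump over `k`. -/
abbrev jump (B : Set ℕ) (k : ℕ) : Set (ℕ → ℕ) := jumpThen B k Set.univ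

theorem disjoint_inter_Iio_singleton (B : Set ℕ) (k : ℕ) :
    Disjoint (B ∩ Set.Iio k) {k + 1} :=
  Set.disjoint_singleton_right.2 fun hmem => absurd hmem.2 (not_lt.2 k.le_succ)

section Paths

variable {x : ℕ → ℕ} {k l : ℕ}

theorem Legal.exists_jump_of_ne (hx : Legal x) (h0 : x 0 < k) {s : ℕ} (hs : k ≤ x s)
    (hne : ∀ i ≤ s, x i ≠ k) : ∃ t < s, (∀ i ≤ t, x i < k) ∧ x (t + 1) = k + 1 := by
  obtain ⟨t, hts, hbelow, hpass⟩ := exists_first_passage h0 hs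
  refine ⟨t, hts, hbelow, ?_⟩
  have hlt := hbelow t le_rfl
  have hstep := hx t
  have hne' := hne (t + 1) hts
  omega

theorem mem_avoid_iff_shift {t : ℕ} (hbelow : ∀ i ≤ t, x i < k) :
    x ∈ avoid k ↔ (fun i => x (t + 1 + i)) ∈ avoid k := by
  refine ⟨fun hx i => hx _, fun hx n => ?_⟩
  rcases Nat.lt_or_ge t n with hn | hn
  · obtain ⟨i, rfl⟩ := Nat.exists_eq_add_of_le (Nat.succ_le_of_lt hn)
    exact hx i
  · exact (hbelow n hn).ne

theorem mem_avoid_of_mem_jumpThen {B : Set ℕ} (hx : x ∈ jumpThen B k (avoid k)) :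
    x ∈ avoid k := by
  obtain ⟨t, hstay, -, havoid⟩ := hx
  exact (mem_avoid_iff_shift fun i hi => (hstay i hi).2).2 havoid

theorem Legal.mem_jumpThen_of_mem_avoid (hx : Legal x) (hunb : ∀ n, ∃ t, n ≤ x t)
    (h0 : x 0 < k) {B : Set ℕ} (hB : ∀ t, x t ∈ B) (hk : x ∈ avoid k) :
    x ∈ jumpThen B k (avoid k) := by
  obtain ⟨s, hs⟩ := hunb k
  obtain ⟨t, -, hbelow, hjump⟩ := hx.exists_jump_of_ne h0 hs fun i _ => hk i
  exact ⟨t, fun i hi => ⟨hB i, hbelow i hi⟩, hjump, fun i => hk _⟩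

theorem Legal.notMem_avoid_succ (hx : Legal x) (hunb : ∀ n, ∃ t, n ≤ x t) (h0 : x 0 < k)
    (hk : x ∈ avoid k) : x ∉ avoid (k + 1) := by
  obtain ⟨s, hs⟩ := hunb k
  obtain ⟨t, -, -, hjump⟩ := hx.exists_jump_of_ne h0 hs fun i _ => hk i
  exact fun havoid => havoid (t + 1) hjump

theorem Legal.mem_jumpThen_climb (hx : Legal x) (h0 : x 0 < k) (hkl : k + 1 < l)
    (hjump : x ∈ jump {k}ᶜ l) : x ∈ jumpThen Set.univ k (climb k l) := by
  obtain ⟨t, hstay, hl, -⟩ := hjump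
  rw [Set.mem_singleton_iff] at hl
  have hne : ∀ i ≤ t + 1, x i ≠ k := fun i hi => by
    rcases Nat.lt_or_ge t i with hti | hit
    · obtain rfl : i = t + 1 := by omega
      omega
    · exact (hstay i hit).1
  obtain ⟨s, hst, hbelow, hk⟩ := hx.exists_jump_of_ne h0 (by omega : k ≤ x (t + 1)) hne
  have hst' : s ≠ t := fun heq => by subst heq; omega
  obtain ⟨d, rfl⟩ : ∃ d, t = s + 1 + d := Nat.exists_eq_add_of_le (by omega)
  refine ⟨s, fun i hi => ⟨trivial, hbelow i hi⟩, hk, d, fun i hi => ⟨?_, ?_⟩, ?_, trivial⟩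
  · exact hx.lt_of_ne (s := s + 1) (by omega) (by omega) fun j _ hj => hne j (by omega)
  · exact (hstay (s + 1 + i) (by omega)).2
  · exact (l.le_succ).trans hl.ge

theorem mem_jump_compl_of_mem_jumpThen_jump (hkl : k ≤ l)
    (hx : x ∈ jumpThen Set.univ k (jump (Set.Ioi k) l)) : x ∈ jump {k}ᶜ l := by
  obtain ⟨s, hbelow, -, t, hstay, hjump, -⟩ := hx
  refine ⟨s + 1 + t, fun i hi => ?_, hjump, trivial⟩
  rcases Nat.lt_or_ge s i with hsi | his
  · obtain ⟨j, rfl⟩ := Nat.exists_eq_add_of_le (Nat.succ_le_of_lt hsi)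
    have hmem := hstay j (by omega)
    exact ⟨hmem.1.ne', hmem.2⟩
  · have hlt : x i < k := (hbelow i his).2
    exact ⟨hlt.ne, hlt.trans_le hkl⟩

end Paths

variable {Ω : Type*} [MeasurableSpace Ω] {P : Measure Ω} {p ξ : ℕ → ℝ} {X : ℕ → Ω → ℕ}

theorem IsWalk.ae_restrict_exitAt_singleton (hX : IsWalk P p X) (B : Set ℕ) (a t : ℕ) :
    ∀ᵐ ω ∂P.restrict (exitAt X B {a} t), X (t + 1 + 0) ω = a :=
  (ae_restrict_iff' (hX.measurableSet_exitAt B {a} t)).2 (.of_forall fun _ hω => hω.2)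

theorem IsWalk.measure_jumpThen_avoid [IsFiniteMeasure P] (hX : IsWalk P p X)
    (hξ : IsTailSolution p ξ) (B : Set ℕ) (k : ℕ) :
    P (traj X ⁻¹' jumpThen B k (avoid k)) = P (traj X ⁻¹' jump B k) / D ξ k := by
  have hdisj := disjoint_inter_Iio_singleton B k
  rw [hX.measure_exitThen hdisj (measurableSet_avoid k), hX.measure_exitInto hdisj,
    div_eq_mul_inv, ← ENNReal.tsum_mul_right]
  refine tsum_congr fun t => ?_
  rw [(hX.isWalk_restrict_exitAt _ _ t).measure_avoid hξ (hX.ae_restrict_exitAt_singleton _ _ t),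
    Measure.restrict_apply_univ, div_eq_mul_inv]

theorem IsWalk.mul_measure_jumpThen_climb_le (hX : IsWalk P p X)
    (hξ : IsTailSolution p ξ) (B : Set ℕ) {k l : ℕ} (hkl : k + 1 < l) :
    ENNReal.ofReal (DFin ξ k l) * P (traj X ⁻¹' jumpThen B k (climb k l)) ≤
      P (traj X ⁻¹' jump B k) := by
  have hdisj := disjoint_inter_Iio_singleton B k
  rw [hX.measure_exitThen hdisj (measurableSet_exitThen _ _ .univ), hX.measure_exitInto hdisj,
    ← ENNReal.tsum_mul_left]
  refine ENNReal.tsum_le_tsum fun t => ?_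
  rw [← Measure.restrict_apply_univ (exitAt X _ _ t)]
  exact (hX.isWalk_restrict_exitAt _ _ t).mul_measure_climb_le hξ
    (hX.ae_restrict_exitAt_singleton _ _ t) hkl

-- The path from the jump over `k` on is independent of the path before it.
theorem IsWalk.measure_jump_mul_measure_jumpThen [IsFiniteMeasure P] (hX : IsWalk P p X)
    (B B' : Set ℕ) (k : ℕ) {S : Set (ℕ → ℕ)} (hS : MeasurableSet S) :
    P (traj X ⁻¹' jump B' k) * P (traj X ⁻¹' jumpThen B k S) =
      P (traj X ⁻¹' jump B k) * P (traj X ⁻¹' jumpThen B' k S) := by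
  have hB := disjoint_inter_Iio_singleton B k
  have hB' := disjoint_inter_Iio_singleton B' k
  simp only [hX.measure_exitThen hB hS, hX.measure_exitThen hB' hS, hX.measure_exitInto hB,
    hX.measure_exitInto hB', ← ENNReal.tsum_mul_left, ← ENNReal.tsum_mul_right]
  rw [ENNReal.tsum_comm]
  refine tsum_congr fun s => tsum_congr fun t => ?_
  simpa only [Measure.restrict_apply_univ] using
    (hX.isWalk_restrict_exitAt _ _ t).law_unique (hX.isWalk_restrict_exitAt _ _ s)
      (hX.ae_restrict_exitAt_singleton _ _ t) (hX.ae_restrict_exitAt_singleton _ _ s) hS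

end Jumps

section Crossing

variable {Ω : Type*} [MeasurableSpace Ω] {P : Measure Ω} {p ξ : ℕ → ℝ} {X : ℕ → Ω → ℕ} {ε : ℝ}

/-- Away from `0`, both transition probabilities of the walk are at least `ε > 0`. -/
structure UniformlyElliptic (ε : ℝ) (p : ℕ → ℝ) : Prop where
  pos : 0 < ε
  mem_Icc : ∀ n, 1 ≤ n → p n ∈ Set.Icc ε (1 - ε)

/-- An upper bound for the inverse of the probability that a walk with `UniformlyElliptic ε p`
which climbs over a site jumps over it: either it does so at its first passage, or the detour
`j + 1 → j → j + 2 → j + 4` replaces the step `j + 1 → j + 3`. -/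
noncomputable def jumpConst (ε : ℝ) : ℝ≥0∞ := 1 + ENNReal.ofReal ε⁻¹ ^ 3

theorem jumpConst_ne_top (ε : ℝ) : jumpConst ε ≠ ∞ :=
  ENNReal.add_ne_top.2 ⟨ENNReal.one_ne_top, ENNReal.pow_ne_top ENNReal.ofReal_ne_top⟩

theorem jumpConst_toReal_pos (ε : ℝ) : 0 < (jumpConst ε).toReal :=
  ENNReal.toReal_pos (zero_lt_one.trans_le le_self_add).ne' (jumpConst_ne_top ε)

theorem UniformlyElliptic.measure_le_mul_measure_step (hε : UniformlyElliptic ε p)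
    (hX : IsWalk P p X) {t : ℕ} {C : Set Ω} (hC : MeasurableSet[hX.past t] C) {a b : ℕ}
    (ha : 1 ≤ a) (hab : b = a + 2 ∨ b + 1 = a) (hCa : ∀ ω ∈ C, X t ω = a) :
    P C ≤ ENNReal.ofReal ε⁻¹ * P (C ∩ X (t + 1) ⁻¹' {b}) := by
  have htrans : ε ≤ trans p a b := by
    obtain ⟨hlower, hupper⟩ := hε.mem_Icc a ha
    rcases hab with rfl | rfl
    · simpa [trans, show a ≠ 0 by omega] using hlower
    · simp only [trans, show b ≠ b + 1 + 2 by omega, if_false, Nat.succ_ne_zero, if_true]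
      linarith
  calc P C = P C * (ENNReal.ofReal ε⁻¹ * ENNReal.ofReal ε) := by
        rw [← ENNReal.ofReal_mul (inv_nonneg.2 hε.pos.le), inv_mul_cancel₀ hε.pos.ne',
          ENNReal.ofReal_one, mul_one]
    _ ≤ P C * (ENNReal.ofReal ε⁻¹ * ENNReal.ofReal (trans p a b)) := by gcongr
    _ = ENNReal.ofReal ε⁻¹ * P (C ∩ X (t + 1) ⁻¹' {b}) := by
        rw [hX.measure_step hC hCa]
        ring

theorem UniformlyElliptic.measure_stay_le_mul_measure_detour (hε : UniformlyElliptic ε p)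
    (hX : IsWalk P p X) {B : Set ℕ} {j : ℕ} (hj : 1 ≤ j) (hjB : j ∈ B) (hjB' : j + 2 ∈ B)
    (t : ℕ) :
    P (stay X B t ∩ X t ⁻¹' {j + 1}) ≤
      ENNReal.ofReal ε⁻¹ ^ 3 * P (exitAt X B {j + 4} (t + 2)) := by
  let C₀ := stay X B t ∩ X t ⁻¹' {j + 1}
  let C₁ := C₀ ∩ X (t + 1) ⁻¹' {j}
  let C₂ := C₁ ∩ X (t + 2) ⁻¹' {j + 2}
  have hC₀ : MeasurableSet[hX.past t] C₀ :=
    (hX.measurableSet_past_stay B t).inter (hX.measurable_past le_rfl .of_discrete)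
  have hC₁ : MeasurableSet[hX.past (t + 1)] C₁ :=
    (hX.past.mono t.le_succ _ hC₀).inter (hX.measurable_past le_rfl .of_discrete)
  have hC₂ : MeasurableSet[hX.past (t + 2)] C₂ :=
    (hX.past.mono (t + 1).le_succ _ hC₁).inter (hX.measurable_past le_rfl .of_discrete)
  have hsub : C₂ ∩ X (t + 2 + 1) ⁻¹' {j + 4} ⊆ exitAt X B {j + 4} (t + 2) := by
    rintro ω ⟨⟨⟨⟨hstay, -⟩, h1⟩, h2⟩, h3⟩
    refine ⟨?_, h3⟩
    rw [stay_succ, stay_succ]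
    exact ⟨⟨hstay, by rwa [Set.mem_preimage, h1]⟩, by rwa [Set.mem_preimage, h2]⟩
  calc P C₀ ≤ ENNReal.ofReal ε⁻¹ * P C₁ :=
        hε.measure_le_mul_measure_step hX hC₀ (by omega) (.inr rfl) fun ω hω => hω.2
    _ ≤ ENNReal.ofReal ε⁻¹ * (ENNReal.ofReal ε⁻¹ * P C₂) := by
        gcongr
        exact hε.measure_le_mul_measure_step hX hC₁ hj (.inl rfl) fun ω hω => hω.2
    _ ≤ ENNReal.ofReal ε⁻¹ * (ENNReal.ofReal ε⁻¹ *
          (ENNReal.ofReal ε⁻¹ * P (C₂ ∩ X (t + 2 + 1) ⁻¹' {j + 4}))) := by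
        gcongr
        exact hε.measure_le_mul_measure_step hX hC₂ (by omega) (.inl rfl) fun ω hω => hω.2
    _ ≤ ENNReal.ofReal ε⁻¹ * (ENNReal.ofReal ε⁻¹ *
          (ENNReal.ofReal ε⁻¹ * P (exitAt X B {j + 4} (t + 2)))) := by gcongr
    _ = ENNReal.ofReal ε⁻¹ ^ 3 * P (exitAt X B {j + 4} (t + 2)) := by ring

theorem UniformlyElliptic.measure_cross_le (hε : UniformlyElliptic ε p) (hX : IsWalk P p X)
    {B : Set ℕ} {k : ℕ} (hk : 4 ≤ k) (hkB : k - 3 ∈ B) (hkB' : k - 1 ∈ B) :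
    P (traj X ⁻¹' exitInto (B ∩ Set.Iio k) (Set.Ici k)) ≤
      jumpConst ε * P (traj X ⁻¹' jump B k) := by
  obtain ⟨j, rfl⟩ := Nat.exists_eq_add_of_le' (show 3 ≤ k by omega)
  have hdisj : Disjoint (B ∩ Set.Iio (j + 3)) (Set.Ici (j + 3)) :=
    Set.disjoint_left.2 fun _ hx hx' => not_lt.2 (Set.mem_Ici.1 hx') hx.2
  have hexit : ∀ t, P (exitAt X (B ∩ Set.Iio (j + 3)) (Set.Ici (j + 3)) t) ≤
      P (exitAt X (B ∩ Set.Iio (j + 3)) {j + 4} t) +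
        P (stay X (B ∩ Set.Iio (j + 3)) t ∩ X t ⁻¹' {j + 1}) := by
    intro t
    refine le_trans (measure_mono_ae ?_) (measure_union_le _ _)
    filter_upwards [hX.ae_legal] with ω hlegal
    rintro ⟨hstay, hpass : j + 3 ≤ X (t + 1) ω⟩
    have hlt : X t ω < j + 3 := (hstay t le_rfl).2
    have hstep : X (t + 1) ω = X t ω + 2 ∨ X (t + 1) ω + 1 = X t ω := hlegal t
    rcases hstep with hup | hdown
    · rcases Nat.lt_or_ge (X t ω) (j + 2) with hj' | hj'
      · exact .inr ⟨hstay, show X t ω = j + 1 by omega⟩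
      · exact .inl ⟨hstay, show X (t + 1) ω = j + 4 by omega⟩
    · omega
  have hdetour := hε.measure_stay_le_mul_measure_detour hX (B := B ∩ Set.Iio (j + 3)) (j := j)
    (by omega) ⟨hkB, show j < j + 3 by omega⟩ ⟨hkB', show j + 2 < j + 3 by omega⟩
  rw [hX.measure_exitInto hdisj, hX.measure_exitInto (disjoint_inter_Iio_singleton B (j + 3))]
  set J : ℕ → ℝ≥0∞ := fun t => P (exitAt X (B ∩ Set.Iio (j + 3)) {j + 4} t)
  calc ∑' t, P (exitAt X (B ∩ Set.Iio (j + 3)) (Set.Ici (j + 3)) t)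
      ≤ ∑' t, (J t + ENNReal.ofReal ε⁻¹ ^ 3 * J (t + 2)) :=
        ENNReal.tsum_le_tsum fun t => (hexit t).trans (add_le_add le_rfl (hdetour t))
    _ = ∑' t, J t + ENNReal.ofReal ε⁻¹ ^ 3 * ∑' t, J (t + 2) := by
        rw [ENNReal.tsum_add, ENNReal.tsum_mul_left]
    _ ≤ ∑' t, J t + ENNReal.ofReal ε⁻¹ ^ 3 * ∑' t, J t := by
        refine add_le_add le_rfl (mul_le_mul' le_rfl ?_)
        exact ENNReal.tsum_comp_le_tsum_of_injective (add_left_injective 2) J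
    _ = jumpConst ε * ∑' t, J t := by rw [jumpConst, one_add_mul]

variable {k l : ℕ}

theorem UniformlyElliptic.le_mul_measure_jump [IsFiniteMeasure P] (hε : UniformlyElliptic ε p)
    (hξ : IsTailSolution p ξ) (hX : IsWalk P p X) (hk : 4 ≤ k) (h0 : ∀ᵐ ω ∂P, X 0 ω < k) :
    P Set.univ ≤ jumpConst ε * P (traj X ⁻¹' jump Set.univ k) := by
  refine le_trans (measure_mono_ae ?_) (hε.measure_cross_le hX hk trivial trivial)
  filter_upwards [hξ.ae_unbounded hX, h0] with ω hunb hω _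
  obtain ⟨s, hs⟩ := hunb k
  obtain ⟨t, -, hbelow, hpass⟩ := exists_first_passage (x := traj X ω) hω hs
  exact ⟨t, fun i hi => ⟨trivial, hbelow i hi⟩, hpass, trivial⟩

theorem UniformlyElliptic.measure_jump_le_mul_measure_jumpThen_jump [IsFiniteMeasure P]
    (hε : UniformlyElliptic ε p) (hξ : IsTailSolution p ξ) (hX : IsWalk P p X) (B : Set ℕ)
    (hkl : k + 4 ≤ l) :
    P (traj X ⁻¹' jump B k) ≤ ENNReal.ofReal (DFin ξ k (l + 1)) *
      (jumpConst ε * P (traj X ⁻¹' jumpThen B k (jump (Set.Ioi k) l))) := by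
  have hdisj := disjoint_inter_Iio_singleton B k
  rw [hX.measure_exitThen hdisj (measurableSet_exitThen _ _ .univ), hX.measure_exitInto hdisj,
    ← ENNReal.tsum_mul_left, ← ENNReal.tsum_mul_left]
  refine ENNReal.tsum_le_tsum fun t => ?_
  have hshift := hX.isWalk_restrict_exitAt (B ∩ Set.Iio k) {k + 1} t
  rw [← Measure.restrict_apply_univ (exitAt X _ _ t)]
  refine (hshift.le_mul_measure_climb hξ (hX.ae_restrict_exitAt_singleton _ _ t)
    (show k + 1 < l by omega)).trans (mul_le_mul' le_rfl ?_)
  exact hε.measure_cross_le hshift (by omega) (show k < l - 3 by omega) (show k < l - 1 by omega)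

theorem UniformlyElliptic.le_mul_measure_jump_compl [IsFiniteMeasure P]
    (hε : UniformlyElliptic ε p) (hξ : IsTailSolution p ξ) (hX : IsWalk P p X) (hk : 4 ≤ k)
    (hkl : k + 4 ≤ l) (h0 : ∀ᵐ ω ∂P, X 0 ω < k) :
    P Set.univ ≤ jumpConst ε ^ 2 *
      (ENNReal.ofReal (DFin ξ k (l + 1)) * P (traj X ⁻¹' jump {k}ᶜ l)) := by
  calc P Set.univ ≤ jumpConst ε * P (traj X ⁻¹' jump Set.univ k) :=
        hε.le_mul_measure_jump hξ hX hk h0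
    _ ≤ jumpConst ε * (ENNReal.ofReal (DFin ξ k (l + 1)) *
          (jumpConst ε * P (traj X ⁻¹' jumpThen Set.univ k (jump (Set.Ioi k) l)))) := by
        gcongr
        exact hε.measure_jump_le_mul_measure_jumpThen_jump hξ hX _ hkl
    _ ≤ jumpConst ε * (ENNReal.ofReal (DFin ξ k (l + 1)) *
          (jumpConst ε * P (traj X ⁻¹' jump {k}ᶜ l))) := by
        gcongr
        exact fun x hx => mem_jump_compl_of_mem_jumpThen_jump (by omega) hx
    _ = jumpConst ε ^ 2 * (ENNReal.ofReal (DFin ξ k (l + 1)) *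
          P (traj X ⁻¹' jump {k}ᶜ l)) := by ring

end Crossing

section SkipProbabilities

variable {Ω : Type*} [MeasurableSpace Ω] {P : Measure Ω} [IsFiniteMeasure P] {p ξ : ℕ → ℝ}
  {X : ℕ → Ω → ℕ} {ε : ℝ} {k l : ℕ}

theorem IsWalk.measure_avoid_eq_measure_jump_div (hX : IsWalk P p X) (hξ : IsTailSolution p ξ)
    (h0 : ∀ᵐ ω ∂P, X 0 ω < k) :
    P (traj X ⁻¹' avoid k) = P (traj X ⁻¹' jump Set.univ k) / D ξ k := by
  rw [← hX.measure_jumpThen_avoid hξ]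
  refine measure_congr ?_
  filter_upwards [hX.ae_legal, hξ.ae_unbounded hX, h0] with ω hlegal hunb hω
  exact propext ⟨hlegal.mem_jumpThen_of_mem_avoid hunb hω fun _ => trivial,
    mem_avoid_of_mem_jumpThen⟩

theorem IsWalk.measure_avoid_le (hX : IsWalk P p X) (hξ : IsTailSolution p ξ)
    (h0 : ∀ᵐ ω ∂P, X 0 ω < k) : P (traj X ⁻¹' avoid k) ≤ P Set.univ / D ξ k := by
  rw [hX.measure_avoid_eq_measure_jump_div hξ h0]
  gcongr
  exact Set.subset_univ _

theorem UniformlyElliptic.le_mul_measure_avoid (hε : UniformlyElliptic ε p)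
    (hξ : IsTailSolution p ξ) (hX : IsWalk P p X) (hk : 4 ≤ k) (h0 : ∀ᵐ ω ∂P, X 0 ω < k) :
    P Set.univ / D ξ k ≤ jumpConst ε * P (traj X ⁻¹' avoid k) := by
  rw [hX.measure_avoid_eq_measure_jump_div hξ h0, ← mul_div_assoc]
  gcongr
  exact hε.le_mul_measure_jump hξ hX hk h0

theorem IsWalk.mul_measure_avoid_inter_le (hX : IsWalk P p X) (hξ : IsTailSolution p ξ)
    (hkl : k < l) (h0 : ∀ᵐ ω ∂P, X 0 ω < k) :
    ENNReal.ofReal (DFin ξ k l) * P (traj X ⁻¹' (avoid k ∩ avoid l)) ≤ P Set.univ / D ξ l := by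
  rcases (Nat.succ_le_of_lt hkl).eq_or_lt with rfl | hkl'
  · have hnull : P (traj X ⁻¹' (avoid k ∩ avoid (k + 1))) = 0 := by
      refine measure_eq_zero_iff_ae_notMem.2 ?_
      filter_upwards [hX.ae_legal, hξ.ae_unbounded hX, h0] with ω hlegal hunb hω hmem
      exact hlegal.notMem_avoid_succ hunb hω hmem.1 hmem.2
    rw [Nat.succ_eq_add_one, hnull, mul_zero]
    exact zero_le
  calc ENNReal.ofReal (DFin ξ k l) * P (traj X ⁻¹' (avoid k ∩ avoid l))
      ≤ ENNReal.ofReal (DFin ξ k l) * P (traj X ⁻¹' jumpThen {k}ᶜ l (avoid l)) := by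
        refine mul_le_mul' le_rfl (measure_mono_ae ?_)
        filter_upwards [hX.ae_legal, hξ.ae_unbounded hX, h0] with ω hlegal hunb hω hmem
        exact hlegal.mem_jumpThen_of_mem_avoid hunb (hω.trans hkl) hmem.1 hmem.2
    _ = ENNReal.ofReal (DFin ξ k l) * P (traj X ⁻¹' jump {k}ᶜ l) / D ξ l := by
        rw [hX.measure_jumpThen_avoid hξ, mul_div_assoc]
    _ ≤ ENNReal.ofReal (DFin ξ k l) * P (traj X ⁻¹' jumpThen Set.univ k (climb k l)) / D ξ l := by
        gcongr ?_ / _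
        refine mul_le_mul' le_rfl (measure_mono_ae ?_)
        filter_upwards [hX.ae_legal, h0] with ω hlegal hω hjump
        exact hlegal.mem_jumpThen_climb hω hkl' hjump
    _ ≤ P Set.univ / D ξ l := by
        gcongr
        exact (hX.mul_measure_jumpThen_climb_le hξ _ hkl').trans (measure_mono (Set.subset_univ _))

theorem UniformlyElliptic.measure_jumpThen_le (hε : UniformlyElliptic ε p)
    (hξ : IsTailSolution p ξ) (hX : IsWalk P p X) (hl : 4 ≤ l) (hlk : l + 4 ≤ k)
    (h0 : ∀ᵐ ω ∂P, X 0 ω < l) {S : Set (ℕ → ℕ)} (hS : MeasurableSet S) :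
    P (traj X ⁻¹' jumpThen Set.univ k S) ≤ jumpConst ε ^ 2 *
      (ENNReal.ofReal (DFin ξ l (k + 1)) * P (traj X ⁻¹' jumpThen {l}ᶜ k S)) := by
  by_cases hP : P Set.univ = 0
  · rw [measure_mono_null (Set.subset_univ _) hP]
    exact zero_le
  rw [← ENNReal.mul_le_mul_iff_right hP (measure_ne_top _ _)]
  calc P Set.univ * P (traj X ⁻¹' jumpThen Set.univ k S)
      ≤ jumpConst ε ^ 2 * (ENNReal.ofReal (DFin ξ l (k + 1)) * P (traj X ⁻¹' jump {l}ᶜ k)) *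
          P (traj X ⁻¹' jumpThen Set.univ k S) := by
        gcongr
        exact hε.le_mul_measure_jump_compl hξ hX hl hlk h0
    _ = jumpConst ε ^ 2 * (ENNReal.ofReal (DFin ξ l (k + 1)) *
          (P (traj X ⁻¹' jump {l}ᶜ k) * P (traj X ⁻¹' jumpThen Set.univ k S))) := by ring
    _ = jumpConst ε ^ 2 * (ENNReal.ofReal (DFin ξ l (k + 1)) *
          (P (traj X ⁻¹' jump Set.univ k) * P (traj X ⁻¹' jumpThen {l}ᶜ k S))) := by
        rw [hX.measure_jump_mul_measure_jumpThen _ _ k hS]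
    _ ≤ jumpConst ε ^ 2 * (ENNReal.ofReal (DFin ξ l (k + 1)) *
          (P Set.univ * P (traj X ⁻¹' jumpThen {l}ᶜ k S))) := by
        gcongr
        exact Set.subset_univ _
    _ = P Set.univ * (jumpConst ε ^ 2 * (ENNReal.ofReal (DFin ξ l (k + 1)) *
          P (traj X ⁻¹' jumpThen {l}ᶜ k S))) := by ring

end SkipProbabilities

section Logarithm

theorem log_sub_log_le_sum_one_div {m n : ℕ} (hm : 0 < m) (hmn : m ≤ n) :
    Real.log n - Real.log m ≤ ∑ i ∈ Finset.Ico m n, 1 / (i : ℝ) := by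
  induction n, hmn using Nat.le_induction with
  | base => simp
  | succ n hmn ih =>
    have hn : (0 : ℝ) < n := by exact_mod_cast hm.trans_le hmn
    have hstep : Real.log ((n + 1 : ℕ) : ℝ) - Real.log n ≤ 1 / n := by
      rw [← Real.log_div (by positivity) hn.ne']
      refine (Real.log_le_sub_one_of_pos (by positivity)).trans_eq ?_
      push_cast
      field_simp
      ring
    rw [Finset.sum_Ico_succ_top hmn]
    linarith

theorem half_log_le_sum_one_div {a k : ℕ} (ha : 25 ≤ a) (hk : 2 * a < k) :
    Real.log a / 2 ≤ ∑ l ∈ Finset.Ioc a (k - 4), 1 / ((k : ℝ) + 1 - l) := by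
  have hreflect : ∑ l ∈ Finset.Ioc a (k - 4), 1 / ((k : ℝ) + 1 - l) =
      ∑ i ∈ Finset.Ico 5 (k + 1 - a), 1 / (i : ℝ) := by
    refine Finset.sum_nbij' (fun l => k + 1 - l) (fun i => k + 1 - i) ?_ ?_ ?_ ?_ ?_ <;>
      simp only [Finset.mem_Ioc, Finset.mem_Ico]
    case refine_5 =>
      intro l hl
      rw [Nat.cast_sub (by omega)]
      push_cast
      rfl
    all_goals omega
  have hlog_le : Real.log a ≤ Real.log (k + 1 - a : ℕ) :=
    Real.log_le_log (by exact_mod_cast (by omega : 0 < a))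
      (by exact_mod_cast (by omega : a ≤ k + 1 - a))
  have hlog_five : Real.log (5 : ℕ) ≤ Real.log a / 2 := by
    have hsq : Real.log ((5 : ℝ) ^ 2) ≤ Real.log a :=
      Real.log_le_log (by norm_num) (by norm_num; exact_mod_cast ha)
    rw [Real.log_pow] at hsq
    push_cast at hsq ⊢
    linarith
  rw [hreflect]
  linarith [log_sub_log_le_sum_one_div (m := 5) (n := k + 1 - a) (by omega) (by omega)]

end Logarithm

section LastAvoided

/-- The paths for which `k` is the last site of `[k, b]` that is never visited. -/
def lastAvoided (b k : ℕ) : Set (ℕ → ℕ) := avoid k ∩ ⋂ j ∈ Set.Ioc k b, (avoid j)ᶜ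

theorem measurableSet_lastAvoided (b k : ℕ) : MeasurableSet (lastAvoided b k) :=
  (measurableSet_avoid k).inter
    (.biInter (Set.to_countable _) fun j _ => (measurableSet_avoid j).compl)

theorem pairwiseDisjoint_lastAvoided (b : ℕ) :
    (Set.Iic b).PairwiseDisjoint (lastAvoided b) := by
  have hlt : ∀ k k', k < k' → k' ≤ b → Disjoint (lastAvoided b k) (lastAvoided b k') :=
    fun k k' hkk' hk' => Set.disjoint_left.2 fun x hx hx' =>
      Set.mem_iInter₂.1 hx.2 k' ⟨hkk', hk'⟩ hx'.1
  intro k hk k' hk' hne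
  rcases lt_or_gt_of_ne hne with h | h
  · exact hlt k k' h hk'
  · exact (hlt k' k h hk).symm

theorem biUnion_avoid_subset_biUnion_lastAvoided (m b : ℕ) :
    ⋃ k ∈ Finset.Ioc m b, avoid k ⊆ ⋃ k ∈ Finset.Ioc m b, lastAvoided b k := by
  classical
  intro x hx
  simp only [Set.mem_iUnion] at hx
  obtain ⟨k, hk, hxk⟩ := hx
  let avoided := (Finset.Ioc m b).filter fun k => x ∈ avoid k
  have hne : avoided.Nonempty := ⟨k, Finset.mem_filter.2 ⟨hk, hxk⟩⟩
  obtain ⟨hmax, hxmax⟩ := Finset.mem_filter.1 (avoided.max'_mem hne)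
  refine Set.mem_iUnion₂.2 ⟨_, hmax, hxmax, Set.mem_iInter₂.2 fun j hj hxj => ?_⟩
  refine hj.1.not_ge (avoided.le_max' j (Finset.mem_filter.2 ⟨Finset.mem_Ioc.2 ⟨?_, hj.2⟩, hxj⟩))
  exact (Finset.mem_Ioc.1 hmax).1.trans hj.1

variable {x : ℕ → ℕ} {b k l : ℕ}

theorem mem_lastAvoided_iff_shift {t : ℕ} (hbelow : ∀ i ≤ t, x i < k) :
    x ∈ lastAvoided b k ↔ (fun i => x (t + 1 + i)) ∈ lastAvoided b k := by
  simp only [lastAvoided, Set.mem_inter_iff, Set.mem_iInter, Set.mem_compl_iff]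
  refine and_congr (mem_avoid_iff_shift hbelow) (forall₂_congr fun j hj => not_congr ?_)
  exact mem_avoid_iff_shift fun i hi => (hbelow i hi).trans hj.1

theorem Legal.mem_jumpThen_lastAvoided (hx : Legal x) (hunb : ∀ n, ∃ t, n ≤ x t)
    (h0 : x 0 < k) (hk : x ∈ lastAvoided b k) :
    x ∈ jumpThen Set.univ k (lastAvoided b k) := by
  obtain ⟨t, hstay, hjump, -⟩ := hx.mem_jumpThen_of_mem_avoid hunb h0 (B := Set.univ)
    (fun _ => trivial) hk.1
  exact ⟨t, hstay, hjump, (mem_lastAvoided_iff_shift fun i hi => (hstay i hi).2).1 hk⟩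

theorem Legal.mem_avoid_inter_lastAvoided (hx : Legal x) (hlk : l ≤ k)
    (hjump : x ∈ jumpThen {l}ᶜ k (lastAvoided b k)) : x ∈ avoid l ∩ lastAvoided b k := by
  obtain ⟨t, hstay, hk, hlast⟩ := hjump
  rw [← mem_lastAvoided_iff_shift fun i hi => (hstay i hi).2] at hlast
  refine ⟨fun n => ?_, hlast⟩
  rcases Nat.lt_or_ge t n with hn | hn
  · have habove : k < x n :=
      hx.lt_of_ne (s := t + 1) (by rw [hk]; exact k.lt_succ_self) hn fun i _ _ => hlast.1 i
    omega
  · exact (hstay n hn).1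

variable {Ω : Type*} [MeasurableSpace Ω] {P : Measure Ω} {p ξ : ℕ → ℝ} {X : ℕ → Ω → ℕ} {ε : ℝ}
  {a : ℕ}

theorem IsWalk.sum_measure_avoid_inter_lastAvoided_le (hX : IsWalk P p X) (l m b : ℕ) :
    ∑ k ∈ Finset.Ioc m b, P (traj X ⁻¹' (avoid l ∩ lastAvoided b k)) ≤
      P (traj X ⁻¹' avoid l) := by
  rw [← measure_biUnion_finset]
  · exact measure_mono (Set.iUnion₂_subset fun k _ => Set.preimage_mono Set.inter_subset_left)
  · intro k hk k' hk' hne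
    exact ((pairwiseDisjoint_lastAvoided b (Finset.mem_Ioc.1 hk).2 (Finset.mem_Ioc.1 hk').2
      hne).mono Set.inter_subset_right Set.inter_subset_right).preimage _
  · exact fun k _ => hX.measurable_traj
      ((measurableSet_avoid l).inter (measurableSet_lastAvoided b k))

variable [IsFiniteMeasure P]

theorem UniformlyElliptic.measure_lastAvoided_le (hε : UniformlyElliptic ε p)
    (hξ : IsTailSolution p ξ) (hX : IsWalk P p X) (hl : 4 ≤ l) (hlk : l + 4 ≤ k)
    (h0 : ∀ᵐ ω ∂P, X 0 ω < l) (b : ℕ) :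
    P (traj X ⁻¹' lastAvoided b k) ≤ jumpConst ε ^ 2 * (ENNReal.ofReal (DFin ξ l (k + 1)) *
      P (traj X ⁻¹' (avoid l ∩ lastAvoided b k))) := by
  calc P (traj X ⁻¹' lastAvoided b k)
      ≤ P (traj X ⁻¹' jumpThen Set.univ k (lastAvoided b k)) := by
        refine measure_mono_ae ?_
        filter_upwards [hX.ae_legal, hξ.ae_unbounded hX, h0] with ω hlegal hunb hω hlast
        exact hlegal.mem_jumpThen_lastAvoided hunb (hω.trans (by omega)) hlast
    _ ≤ jumpConst ε ^ 2 * (ENNReal.ofReal (DFin ξ l (k + 1)) *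
          P (traj X ⁻¹' jumpThen {l}ᶜ k (lastAvoided b k))) :=
        hε.measure_jumpThen_le hξ hX hl hlk h0 (measurableSet_lastAvoided b k)
    _ ≤ jumpConst ε ^ 2 * (ENNReal.ofReal (DFin ξ l (k + 1)) *
          P (traj X ⁻¹' (avoid l ∩ lastAvoided b k))) := by
        refine mul_le_mul' le_rfl (mul_le_mul' le_rfl (measure_mono_ae ?_))
        filter_upwards [hX.ae_legal] with ω hlegal hjump
        exact hlegal.mem_avoid_inter_lastAvoided (by omega) hjump

theorem UniformlyElliptic.measure_lastAvoided_mul_one_div_le (hε : UniformlyElliptic ε p)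
    (hξ : IsTailSolution p ξ) (hU : ∀ n, 1 ≤ n → 1 / ξ n ≤ 1) (hX : IsWalk P p X) (hl : 4 ≤ l)
    (hlk : l + 4 ≤ k) (h0 : ∀ᵐ ω ∂P, X 0 ω < l) (b : ℕ) :
    P (traj X ⁻¹' lastAvoided b k) * ENNReal.ofReal (1 / ((k : ℝ) + 1 - l)) ≤
      jumpConst ε ^ 2 * P (traj X ⁻¹' (avoid l ∩ lastAvoided b k)) := by
  have hpos : (0 : ℝ) < (k : ℝ) + 1 - l := by
    have : (l : ℝ) ≤ k := by exact_mod_cast (by omega : l ≤ k)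
    linarith
  have hDFin : DFin ξ l (k + 1) ≤ (k : ℝ) + 1 - l := by
    exact_mod_cast hξ.DFin_le_sub hU (show l ≤ k + 1 by omega)
  rw [one_div, ENNReal.ofReal_inv_of_pos hpos, ← div_eq_mul_inv]
  refine ENNReal.div_le_of_le_mul ((hε.measure_lastAvoided_le hξ hX hl hlk h0 b).trans ?_)
  rw [mul_assoc, mul_comm (P _)]
  gcongr

theorem UniformlyElliptic.measure_lastAvoided_mul_log_le (hε : UniformlyElliptic ε p)
    (hξ : IsTailSolution p ξ) (hU : ∀ n, 1 ≤ n → 1 / ξ n ≤ 1) (hX : IsWalk P p X)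
    (h0 : ∀ᵐ ω ∂P, X 0 ω ≤ a) (ha : 25 ≤ a) (hak : 2 * a < k) (hkb : k ≤ b) :
    P (traj X ⁻¹' lastAvoided b k) * ENNReal.ofReal (Real.log a / 2) ≤
      jumpConst ε ^ 2 * ∑ l ∈ Finset.Ioc a b, P (traj X ⁻¹' (avoid l ∩ lastAvoided b k)) := by
  have hnonneg : ∀ l ∈ Finset.Ioc a (k - 4), 0 ≤ 1 / ((k : ℝ) + 1 - l) := fun l hl => by
    have : (l : ℝ) ≤ k := by exact_mod_cast ((Finset.mem_Ioc.1 hl).2.trans (Nat.sub_le k 4))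
    exact one_div_nonneg.2 (by linarith)
  calc P (traj X ⁻¹' lastAvoided b k) * ENNReal.ofReal (Real.log a / 2)
      ≤ P (traj X ⁻¹' lastAvoided b k) *
          ENNReal.ofReal (∑ l ∈ Finset.Ioc a (k - 4), 1 / ((k : ℝ) + 1 - l)) := by
        gcongr
        exact half_log_le_sum_one_div ha hak
    _ = ∑ l ∈ Finset.Ioc a (k - 4),
          P (traj X ⁻¹' lastAvoided b k) * ENNReal.ofReal (1 / ((k : ℝ) + 1 - l)) := by
        rw [ENNReal.ofReal_sum_of_nonneg hnonneg, Finset.mul_sum]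
    _ ≤ ∑ l ∈ Finset.Ioc a (k - 4),
          jumpConst ε ^ 2 * P (traj X ⁻¹' (avoid l ∩ lastAvoided b k)) := by
        refine Finset.sum_le_sum fun l hl => ?_
        rw [Finset.mem_Ioc] at hl
        exact hε.measure_lastAvoided_mul_one_div_le hξ hU hX (by omega) (by omega)
          (h0.mono fun ω hω => hω.trans_lt hl.1) b
    _ ≤ ∑ l ∈ Finset.Ioc a b, jumpConst ε ^ 2 * P (traj X ⁻¹' (avoid l ∩ lastAvoided b k)) :=
        Finset.sum_le_sum_of_subset (Finset.Ioc_subset_Ioc_right (by omega))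
    _ = jumpConst ε ^ 2 * ∑ l ∈ Finset.Ioc a b, P (traj X ⁻¹' (avoid l ∩ lastAvoided b k)) := by
        rw [Finset.mul_sum]

end LastAvoided

section FinitelyMany

/-- The paths that avoid some site of the block `(2a, 4a]`. -/
def avoidBlock (a : ℕ) : Set (ℕ → ℕ) := ⋃ k ∈ Finset.Ioc (2 * a) (4 * a), avoid k

/-- The summand of `critSum`; for `n ≤ 1` it has the junk value `∞`. -/
noncomputable def critTerm (ξ : ℕ → ℝ) (n : ℕ) : ℝ≥0∞ :=
  1 / (D ξ n * ENNReal.ofReal (Real.log (n : ℝ)))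

theorem sum_critTerm_le (ξ : ℕ → ℝ) {a : ℕ} (ha : 1 ≤ a) (b : ℕ) :
    ∑ l ∈ Finset.Ioc a b, critTerm ξ l ≤ critSum ξ := by
  calc ∑ l ∈ Finset.Ioc a b, critTerm ξ l
      ≤ ∑ l ∈ Finset.Ico 2 (b + 1), critTerm ξ l := by
        refine Finset.sum_le_sum_of_subset fun l hl => ?_
        simp only [Finset.mem_Ioc, Finset.mem_Ico] at *
        omega
    _ = ∑ i ∈ Finset.range (b + 1 - 2), critTerm ξ (i + 2) := by
        simp_rw [Finset.sum_Ico_eq_sum_range, add_comm 2]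
    _ ≤ critSum ξ := ENNReal.sum_le_tsum _

theorem tsum_sum_critTerm_le (ξ : ℕ → ℝ) {u : ℕ → ℕ} (hu : Monotone u) (hu0 : 1 ≤ u 0) :
    ∑' j, ∑ l ∈ Finset.Ioc (u j) (u (j + 1)), critTerm ξ l ≤ critSum ξ := by
  have htelescope : ∀ J, ∑ j ∈ Finset.range J, ∑ l ∈ Finset.Ioc (u j) (u (j + 1)), critTerm ξ l =
      ∑ l ∈ Finset.Ioc (u 0) (u J), critTerm ξ l := by
    intro J
    induction J with
    | zero => simp
    | succ J ih =>
      rw [Finset.sum_range_succ, ih, Finset.sum_Ioc_consecutive _ (hu J.zero_le) (hu J.le_succ)]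
  rw [ENNReal.tsum_eq_iSup_nat]
  exact iSup_le fun J => (htelescope J).trans_le (sum_critTerm_le ξ hu0 _)

theorem tsum_sum_critTerm_dyadic_ne_top {ξ : ℕ → ℝ} (hcrit : critSum ξ < ∞)
    (i : ℕ) :
    ∑' j, ∑ l ∈ Finset.Ioc (2 ^ (i + j)) (4 * 2 ^ (i + j)), critTerm ξ l ≠ ∞ := by
  have hmono : ∀ i : ℕ, Monotone fun j : ℕ => 2 ^ (i + j) := fun i =>
    (pow_right_mono₀ one_le_two).comp (add_right_mono (a := i))
  have hsplit : ∀ j, ∑ l ∈ Finset.Ioc (2 ^ (i + j)) (4 * 2 ^ (i + j)), critTerm ξ l =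
      ∑ l ∈ Finset.Ioc (2 ^ (i + j)) (2 ^ (i + (j + 1))), critTerm ξ l +
        ∑ l ∈ Finset.Ioc (2 ^ (i + 1 + j)) (2 ^ (i + 1 + (j + 1))), critTerm ξ l := fun j => by
    rw [show i + 1 + j = i + (j + 1) by omega, show i + 1 + (j + 1) = i + (j + 2) by omega,
      Finset.sum_Ioc_consecutive _ (hmono i j.le_succ) (hmono i (j + 1).le_succ),
      show 4 * 2 ^ (i + j) = 2 ^ (i + (j + 2)) by ring]
  simp_rw [hsplit, ENNReal.tsum_add]
  exact ENNReal.add_ne_top.2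
    ⟨ne_top_of_le_ne_top hcrit.ne (tsum_sum_critTerm_le ξ (hmono i) Nat.one_le_two_pow),
      ne_top_of_le_ne_top hcrit.ne (tsum_sum_critTerm_le ξ (hmono (i + 1)) Nat.one_le_two_pow)⟩

theorem one_div_D_le_mul_critTerm (ξ : ℕ → ℝ) {a l : ℕ} (ha : 4 ≤ a) (hal : a < l)
    (hla : l ≤ 4 * a) :
    1 / D ξ l ≤ 4 * ENNReal.ofReal (Real.log a / 2) * critTerm ξ l := by
  have ha' : (4 : ℝ) ≤ a := by exact_mod_cast ha
  have hal' : (a : ℝ) < l := by exact_mod_cast hal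
  have hla' : (l : ℝ) ≤ 4 * a := by exact_mod_cast hla
  have hlog : Real.log l ≤ 4 * (Real.log a / 2) := by
    rw [show 4 * (Real.log a / 2) = Real.log a + Real.log a by ring,
      ← Real.log_mul (by linarith) (by linarith)]
    exact Real.log_le_log (by linarith) (by nlinarith)
  have hlog_ofReal : ENNReal.ofReal (Real.log l) ≤ 4 * ENNReal.ofReal (Real.log a / 2) := by
    rw [← ENNReal.ofReal_ofNat, ← ENNReal.ofReal_mul (by norm_num)]
    exact ENNReal.ofReal_le_ofReal hlog
  have hlog_ne : ENNReal.ofReal (Real.log l) ≠ 0 :=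
    (ENNReal.ofReal_pos.2 (Real.log_pos (by linarith))).ne'
  have hD : D ξ l ≠ 0 := (zero_lt_one.trans_le (one_le_D ξ l)).ne'
  calc 1 / D ξ l = ENNReal.ofReal (Real.log l) * critTerm ξ l := by
        rw [critTerm, one_div, one_div, ENNReal.mul_inv (.inl hD) (.inr hlog_ne), mul_left_comm,
          ENNReal.mul_inv_cancel hlog_ne ENNReal.ofReal_ne_top, mul_one]
    _ ≤ 4 * ENNReal.ofReal (Real.log a / 2) * critTerm ξ l := by gcongr

theorem exists_dyadic {k : ℕ} (hk : 2 < k) : ∃ j, 2 * 2 ^ j < k ∧ k ≤ 4 * 2 ^ j := by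
  have hclog : 1 < Nat.clog 2 k := (Nat.lt_clog_iff_pow_lt one_lt_two).2 hk
  obtain ⟨j, hj⟩ : ∃ j, Nat.clog 2 k = j + 2 := Nat.exists_eq_add_of_le' hclog
  refine ⟨j, ?_, ?_⟩
  · rw [← pow_succ']
    exact (Nat.lt_clog_iff_pow_lt one_lt_two).1 (by omega)
  · rw [show 4 * 2 ^ j = 2 ^ (j + 2) by ring, ← hj]
    exact Nat.le_pow_clog one_lt_two k

theorem finite_of_eventually_notMem_avoidBlock {x : ℕ → ℕ}
    (hx : ∀ᶠ j in atTop, x ∉ avoidBlock (2 ^ j)) : {k | x ∈ avoid k}.Finite := by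
  obtain ⟨J, hJ⟩ := eventually_atTop.1 hx
  refine (Set.finite_Iic (4 * 2 ^ J)).subset fun k hk => ?_
  by_contra hlarge
  have hlarge' : 4 * 2 ^ J < k := not_le.1 hlarge
  have hpow : 1 ≤ 2 ^ J := Nat.one_le_two_pow
  obtain ⟨j, hjk, hkj⟩ := exists_dyadic (show 2 < k by omega)
  have hJj : J < j := (Nat.pow_lt_pow_iff_right one_lt_two).1 (by omega)
  exact hJ j hJj.le (Set.mem_iUnion₂.2 ⟨k, Finset.mem_Ioc.2 ⟨hjk, hkj⟩, hk⟩)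

variable {Ω : Type*} [MeasurableSpace Ω] {P : Measure Ω} {p ξ : ℕ → ℝ} {X : ℕ → Ω → ℕ} {ε : ℝ}
  {a : ℕ}

theorem IsWalk.ae_of_forall_start (hX : IsWalk P p X) {q : Ω → Prop}
    (hq : ∀ x, ∀ᵐ ω ∂P.restrict (X 0 ⁻¹' {x}), q ω) : ∀ᵐ ω ∂P, q ω := by
  have himp : ∀ x, ∀ᵐ ω ∂P, X 0 ω = x → q ω := fun x =>
    (ae_restrict_iff' (hX.measurable 0 (measurableSet_singleton x))).1 (hq x)
  filter_upwards [ae_all_iff.2 himp] with ω hω using hω _ rfl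

variable [IsFiniteMeasure P]

theorem UniformlyElliptic.measure_avoidBlock_mul_log_le (hε : UniformlyElliptic ε p)
    (hξ : IsTailSolution p ξ) (hU : ∀ n, 1 ≤ n → 1 / ξ n ≤ 1) (hX : IsWalk P p X)
    (h0 : ∀ᵐ ω ∂P, X 0 ω ≤ a) (ha : 25 ≤ a) :
    P (traj X ⁻¹' avoidBlock a) * ENNReal.ofReal (Real.log a / 2) ≤
      jumpConst ε ^ 2 * ∑ l ∈ Finset.Ioc a (4 * a), P Set.univ / D ξ l := by
  have hcover : P (traj X ⁻¹' avoidBlock a) ≤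
      ∑ k ∈ Finset.Ioc (2 * a) (4 * a), P (traj X ⁻¹' lastAvoided (4 * a) k) := by
    refine le_trans (measure_mono ?_) (measure_biUnion_finset_le _ _)
    rw [← Set.preimage_iUnion₂]
    exact Set.preimage_mono (biUnion_avoid_subset_biUnion_lastAvoided _ _)
  calc P (traj X ⁻¹' avoidBlock a) * ENNReal.ofReal (Real.log a / 2)
      ≤ ∑ k ∈ Finset.Ioc (2 * a) (4 * a),
          P (traj X ⁻¹' lastAvoided (4 * a) k) * ENNReal.ofReal (Real.log a / 2) := by
        rw [← Finset.sum_mul]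
        gcongr
    _ ≤ ∑ k ∈ Finset.Ioc (2 * a) (4 * a), jumpConst ε ^ 2 * ∑ l ∈ Finset.Ioc a (4 * a),
          P (traj X ⁻¹' (avoid l ∩ lastAvoided (4 * a) k)) := by
        refine Finset.sum_le_sum fun k hk => ?_
        obtain ⟨hak, hka⟩ := Finset.mem_Ioc.1 hk
        exact hε.measure_lastAvoided_mul_log_le hξ hU hX h0 ha hak hka
    _ = jumpConst ε ^ 2 * ∑ l ∈ Finset.Ioc a (4 * a), ∑ k ∈ Finset.Ioc (2 * a) (4 * a),
          P (traj X ⁻¹' (avoid l ∩ lastAvoided (4 * a) k)) := by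
        rw [← Finset.mul_sum, Finset.sum_comm]
    _ ≤ jumpConst ε ^ 2 * ∑ l ∈ Finset.Ioc a (4 * a), P Set.univ / D ξ l := by
        refine mul_le_mul' le_rfl (Finset.sum_le_sum fun l hl => ?_)
        exact (hX.sum_measure_avoid_inter_lastAvoided_le l _ _).trans
          (hX.measure_avoid_le hξ (h0.mono fun ω hω => hω.trans_lt (Finset.mem_Ioc.1 hl).1))

theorem UniformlyElliptic.measure_avoidBlock_le (hε : UniformlyElliptic ε p)
    (hξ : IsTailSolution p ξ) (hU : ∀ n, 1 ≤ n → 1 / ξ n ≤ 1) (hX : IsWalk P p X)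
    (h0 : ∀ᵐ ω ∂P, X 0 ω ≤ a) (ha : 25 ≤ a) :
    P (traj X ⁻¹' avoidBlock a) ≤
      4 * jumpConst ε ^ 2 * P Set.univ * ∑ l ∈ Finset.Ioc a (4 * a), critTerm ξ l := by
  have hlog : ENNReal.ofReal (Real.log a / 2) ≠ 0 := by
    have ha' : (1 : ℝ) < a := by exact_mod_cast (by omega : 1 < a)
    exact (ENNReal.ofReal_pos.2 (half_pos (Real.log_pos ha'))).ne'
  rw [← ENNReal.mul_le_mul_iff_left hlog ENNReal.ofReal_ne_top]
  calc P (traj X ⁻¹' avoidBlock a) * ENNReal.ofReal (Real.log a / 2)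
      ≤ jumpConst ε ^ 2 * ∑ l ∈ Finset.Ioc a (4 * a), P Set.univ / D ξ l :=
        hε.measure_avoidBlock_mul_log_le hξ hU hX h0 ha
    _ = jumpConst ε ^ 2 * P Set.univ * ∑ l ∈ Finset.Ioc a (4 * a), 1 / D ξ l := by
        simp only [div_eq_mul_inv, one_mul, ← Finset.mul_sum, mul_assoc]
    _ ≤ jumpConst ε ^ 2 * P Set.univ *
          ∑ l ∈ Finset.Ioc a (4 * a), 4 * ENNReal.ofReal (Real.log a / 2) * critTerm ξ l := by
        refine mul_le_mul' le_rfl (Finset.sum_le_sum fun l hl => ?_)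
        obtain ⟨hal, hla⟩ := Finset.mem_Ioc.1 hl
        exact one_div_D_le_mul_critTerm ξ (by omega) hal hla
    _ = 4 * jumpConst ε ^ 2 * P Set.univ * (∑ l ∈ Finset.Ioc a (4 * a), critTerm ξ l) *
          ENNReal.ofReal (Real.log a / 2) := by
        rw [← Finset.mul_sum]
        ring

theorem UniformlyElliptic.ae_finite_skipped_of_le (hε : UniformlyElliptic ε p)
    (hξ : IsTailSolution p ξ) (hU : ∀ n, 1 ≤ n → 1 / ξ n ≤ 1) (hX : IsWalk P p X) {K : ℕ}
    (h0 : ∀ᵐ ω ∂P, X 0 ω ≤ K) (hcrit : critSum ξ < ∞) : ∀ᵐ ω ∂P, (skipped X ω).Finite := by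
  have hpow : ∀ j, K ≤ 2 ^ (K + 5 + j) ∧ 25 ≤ 2 ^ (K + 5 + j) := fun j =>
    ⟨Nat.lt_two_pow_self.le.trans (Nat.pow_le_pow_right two_pos (by omega)),
      (by norm_num : 25 ≤ 2 ^ 5).trans (Nat.pow_le_pow_right two_pos (by omega))⟩
  have hsum : ∑' j, P (traj X ⁻¹' avoidBlock (2 ^ (K + 5 + j))) ≠ ∞ := by
    refine ne_top_of_le_ne_top ?_ (ENNReal.tsum_le_tsum fun j =>
      hε.measure_avoidBlock_le hξ hU hX (h0.mono fun ω hω => hω.trans (hpow j).1) (hpow j).2)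
    rw [ENNReal.tsum_mul_left]
    exact ENNReal.mul_ne_top (ENNReal.mul_ne_top (ENNReal.mul_ne_top ENNReal.ofNat_ne_top
      (ENNReal.pow_ne_top (jumpConst_ne_top ε))) (measure_ne_top _ _))
      (tsum_sum_critTerm_dyadic_ne_top hcrit _)
  filter_upwards [ae_eventually_notMem hsum] with ω hω
  refine finite_of_eventually_notMem_avoidBlock ?_
  rw [← map_add_atTop_eq_nat (K + 5)]
  simpa only [eventually_map, add_comm _ (K + 5), Set.mem_preimage] using hω

theorem UniformlyElliptic.ae_finite_skipped (hε : UniformlyElliptic ε p)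
    (hξ : IsTailSolution p ξ) (hU : ∀ n, 1 ≤ n → 1 / ξ n ≤ 1) (hX : IsWalk P p X)
    (hcrit : critSum ξ < ∞) : ∀ᵐ ω ∂P, (skipped X ω).Finite := by
  refine hX.ae_of_forall_start fun x => ?_
  have hstart := hX.restrict_shift (hX.measurable_past (le_refl 0) (measurableSet_singleton x))
  simp only [zero_add] at hstart
  refine hε.ae_finite_skipped_of_le hξ hU hstart (K := x) ?_ hcrit
  exact (ae_restrict_iff' (hX.measurable 0 (measurableSet_singleton x))).2
    (.of_forall fun ω hω => le_of_eq hω)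

end FinitelyMany

section SecondMomentTerms

theorem sub_div_le_two_mul_log_sub_log {a b : ℝ} (ha : 0 < a) (hab : a ≤ b) (hb : b ≤ 2 * a) :
    (b - a) / a ≤ 2 * (Real.log b - Real.log a) := by
  have hb0 : 0 < b := ha.trans_le hab
  have hlog : 1 - a / b ≤ Real.log b - Real.log a := by
    simpa only [Real.log_div hb0.ne' ha.ne', inv_div] using
      Real.one_sub_inv_le_log_of_pos (div_pos hb0 ha)
  have hdiff : 2 * (1 - a / b) - (b - a) / a = (b - a) * (2 * a - b) / (a * b) := by
    field_simp
  have hnonneg : 0 ≤ (b - a) * (2 * a - b) / (a * b) :=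
    div_nonneg (mul_nonneg (by linarith) (by linarith)) (mul_pos ha hb0).le
  linarith

theorem one_le_log {k : ℕ} (hk : 3 ≤ k) : 1 ≤ Real.log k := by
  have hk' : (3 : ℝ) ≤ k := by exact_mod_cast hk
  rw [Real.le_log_iff_exp_le (by linarith)]
  linarith [Real.exp_one_lt_d9]

/-- The relative increment of `DFin ξ k` from `l` to `l + 1`. For `l ≤ k` the denominator vanishes,
and so does the quotient. -/
noncomputable def growthRate (ξ : ℕ → ℝ) (k l : ℕ) : ℝ :=
  (∏ i ∈ Finset.Ico (k + 1) (l + 1), 1 / ξ i) / DFin ξ k l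

/-- The amount by which the events that `k` and `l` are skipped, `k < l`, with weights `1 / log k`
and `1 / log l`, may be positively correlated. It is zero for `l ≤ k`. -/
noncomputable def pairExcess (ξ : ℕ → ℝ) (k l : ℕ) : ℝ :=
  (critTerm ξ k).toReal * (1 / Real.log l * growthRate ξ k l)

variable {p ξ : ℕ → ℝ} {k n s : ℕ}

theorem one_le_toReal_D (hk : D ξ k ≠ ∞) : 1 ≤ (D ξ k).toReal := by
  rw [← ENNReal.toReal_one]
  exact ENNReal.toReal_mono hk (one_le_D ξ k)

theorem D_ne_top_of_le_pow (hD : D ξ k ≤ (k : ℝ≥0∞) ^ s) : D ξ k ≠ ∞ :=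
  ne_top_of_le_ne_top (ENNReal.pow_ne_top (ENNReal.natCast_ne_top k)) hD

theorem log_toReal_D_le (hD : D ξ k ≤ (k : ℝ≥0∞) ^ s) :
    Real.log (D ξ k).toReal ≤ s * Real.log k := by
  rw [← Real.log_pow]
  refine Real.log_le_log (zero_lt_one.trans_le (one_le_toReal_D (D_ne_top_of_le_pow hD))) ?_
  simpa using ENNReal.toReal_mono (ENNReal.pow_ne_top (ENNReal.natCast_ne_top k)) hD

theorem toReal_critTerm (ξ : ℕ → ℝ) (k : ℕ) :
    (critTerm ξ k).toReal = 1 / Real.log k * (1 / (D ξ k).toReal) := by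
  rw [critTerm, ENNReal.toReal_div, ENNReal.toReal_mul,
    ENNReal.toReal_ofReal (Real.log_natCast_nonneg k), ENNReal.toReal_one, one_div_mul_one_div_rev]

theorem growthRate_of_le (ξ : ℕ → ℝ) {k l : ℕ} (hlk : l ≤ k) : growthRate ξ k l = 0 := by
  rw [growthRate, DFin_of_le ξ hlk, div_zero]

theorem pairExcess_of_le (ξ : ℕ → ℝ) {k l : ℕ} (hlk : l ≤ k) : pairExcess ξ k l = 0 := by
  rw [pairExcess, growthRate_of_le ξ hlk, mul_zero, mul_zero]

theorem IsTailSolution.growthRate_nonneg (hξ : IsTailSolution p ξ) (k l : ℕ) :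
    0 ≤ growthRate ξ k l :=
  div_nonneg (hξ.prod_one_div_pos k (l + 1)).le (hξ.DFin_nonneg k l)

theorem IsTailSolution.sum_growthRate_le (hξ : IsTailSolution p ξ)
    (hU : ∀ n, 1 ≤ n → 1 / ξ n ≤ 1) (hkn : k < n) :
    ∑ l ∈ Finset.Ico (k + 1) n, growthRate ξ k l ≤ 2 * Real.log (DFin ξ k n) := by
  induction n, Nat.succ_le_iff.2 hkn using Nat.le_induction with
  | base => simp [DFin_self_succ]
  | succ n hn ih =>
    have hsucc := DFin_succ ξ (show k ≤ n by omega)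
    have hone := hξ.one_le_DFin (show k < n by omega)
    have hprod_le := hξ.prod_one_div_le_one hU k (n + 1)
    have hstep : growthRate ξ k n ≤
        2 * (Real.log (DFin ξ k (n + 1)) - Real.log (DFin ξ k n)) := by
      rw [growthRate, eq_sub_of_add_eq' hsucc.symm]
      exact sub_div_le_two_mul_log_sub_log (by linarith) (hξ.DFin_mono k n.le_succ) (by linarith)
    rw [Finset.sum_Ico_succ_top hn]
    linarith [ih hn]

theorem IsTailSolution.sum_growthRate_le_mul_log (hξ : IsTailSolution p ξ)
    (hU : ∀ n, 1 ≤ n → 1 / ξ n ≤ 1) (hkn : k < n) (hD : D ξ k ≤ (k : ℝ≥0∞) ^ s) :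
    ∑ l ∈ Finset.Ico (k + 1) n, growthRate ξ k l ≤ 2 * s * Real.log k := by
  have hDFin : DFin ξ k n ≤ (D ξ k).toReal :=
    (hξ.DFin_mono k).ge_of_tendsto (hξ.tendsto_DFin_toReal (D_ne_top_of_le_pow hD)) n
  have hlog := Real.log_le_log (zero_lt_one.trans_le (hξ.one_le_DFin hkn)) hDFin
  linarith [hξ.sum_growthRate_le hU hkn, log_toReal_D_le hD]

theorem IsTailSolution.sum_pairExcess_le (hξ : IsTailSolution p ξ)
    (hU : ∀ n, 1 ≤ n → 1 / ξ n ≤ 1) (hk : 2 ≤ k) (hD : D ξ k ≤ (k : ℝ≥0∞) ^ s) {K : ℕ}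
    (hkn : k ∈ Finset.Ico K n) :
    ∑ l ∈ Finset.Ico K n, pairExcess ξ k l ≤ 2 * s * (critTerm ξ k).toReal := by
  obtain ⟨hKk, hkn⟩ := Finset.mem_Ico.1 hkn
  have hlog : 0 < Real.log k := Real.log_pos (by exact_mod_cast hk)
  have hweight : ∀ l ∈ Finset.Ico (k + 1) n,
      1 / Real.log l * growthRate ξ k l ≤ 1 / Real.log k * growthRate ξ k l := fun l hl => by
    refine mul_le_mul_of_nonneg_right (one_div_le_one_div_of_le hlog ?_) (hξ.growthRate_nonneg k l)
    have hkl : k ≤ l := Nat.le_of_succ_le (Finset.mem_Ico.1 hl).1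
    exact Real.log_le_log (by positivity) (by exact_mod_cast hkl)
  calc ∑ l ∈ Finset.Ico K n, pairExcess ξ k l
      = ∑ l ∈ Finset.Ico (k + 1) n, pairExcess ξ k l := by
        refine (Finset.sum_subset (Finset.Ico_subset_Ico_left (by omega)) fun l hl hl' => ?_).symm
        rw [Finset.mem_Ico] at hl hl'
        exact pairExcess_of_le ξ (by omega)
    _ = (critTerm ξ k).toReal * ∑ l ∈ Finset.Ico (k + 1) n, 1 / Real.log l * growthRate ξ k l := by
        rw [Finset.mul_sum]
        rfl
    _ ≤ (critTerm ξ k).toReal * ∑ l ∈ Finset.Ico (k + 1) n, 1 / Real.log k * growthRate ξ k l :=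
        mul_le_mul_of_nonneg_left (Finset.sum_le_sum hweight) ENNReal.toReal_nonneg
    _ ≤ (critTerm ξ k).toReal * (1 / Real.log k * (2 * s * Real.log k)) := by
        rw [← Finset.mul_sum]
        have := hξ.sum_growthRate_le_mul_log hU hkn hD
        gcongr
    _ = 2 * s * (critTerm ξ k).toReal := by
        field_simp

theorem critTerm_ne_top (ξ : ℕ → ℝ) (hk : 2 ≤ k) : critTerm ξ k ≠ ∞ := by
  have hD : D ξ k ≠ 0 := (zero_lt_one.trans_le (one_le_D ξ k)).ne'
  have hlog : 0 < Real.log k := Real.log_pos (by exact_mod_cast hk)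
  exact ENNReal.div_ne_top ENNReal.one_ne_top
    (mul_ne_zero hD (ENNReal.ofReal_pos.2 hlog).ne')

theorem tendsto_sum_toReal_critTerm (hcrit : critSum ξ = ∞) {K : ℕ} (hK : 2 ≤ K) :
    Tendsto (fun n => ∑ k ∈ Finset.Ico K (K + n), (critTerm ξ k).toReal) atTop atTop := by
  simp_rw [Finset.sum_Ico_eq_sum_range, Nat.add_sub_cancel_left]
  rw [← not_summable_iff_tendsto_nat_atTop_of_nonneg fun _ => ENNReal.toReal_nonneg]
  intro hsummable
  have htail : ∑' i, critTerm ξ (K + i) ≠ ∞ := by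
    simpa only [ENNReal.ofReal_toReal (critTerm_ne_top ξ (le_add_right hK))] using
      hsummable.tsum_ofReal_ne_top
  have hsplit : ∑ i ∈ Finset.range (K - 2), critTerm ξ (i + 2) +
      ∑' i, critTerm ξ (i + (K - 2) + 2) = critSum ξ :=
    Summable.sum_add_tsum_nat_add' (f := fun i => critTerm ξ (i + 2)) ENNReal.summable
  simp_rw [hcrit, show ∀ i, i + (K - 2) + 2 = K + i by omega] at hsplit
  exact ENNReal.add_ne_top.2
    ⟨ENNReal.sum_ne_top.2 fun i _ => critTerm_ne_top ξ (by omega), htail⟩ hsplit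

end SecondMomentTerms

section SecondMoment

variable {Ω : Type*} [MeasurableSpace Ω] {P : Measure Ω} {p ξ : ℕ → ℝ} {X : ℕ → Ω → ℕ}
  {ε : ℝ} {k l K n s : ℕ}

/-- The number of skipped points in `[K, n)`, each counted with weight `1 / log k`. -/
noncomputable def weightedCount {Ω : Type*} (X : ℕ → Ω → ℕ) (K n : ℕ) (ω : Ω) : ℝ :=
  ∑ k ∈ Finset.Ico K n, (traj X ⁻¹' avoid k).indicator (fun _ => 1 / Real.log k) ω

theorem IsWalk.measurableSet_preimage_avoid (hX : IsWalk P p X) (k : ℕ) :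
    MeasurableSet (traj X ⁻¹' avoid k) :=
  hX.measurable_traj (measurableSet_avoid k)

theorem IsWalk.measurable_weightedCount (hX : IsWalk P p X) (K n : ℕ) :
    Measurable (weightedCount X K n) :=
  Finset.measurable_sum _ fun k _ =>
    measurable_const.indicator (hX.measurableSet_preimage_avoid k)

theorem weightedCount_sq {Ω : Type*} (X : ℕ → Ω → ℕ) (K n : ℕ) (ω : Ω) :
    weightedCount X K n ω ^ 2 = ∑ k ∈ Finset.Ico K n, ∑ l ∈ Finset.Ico K n,
      (traj X ⁻¹' (avoid k ∩ avoid l)).indicator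
        (fun _ => 1 / Real.log k * (1 / Real.log l)) ω := by
  rw [weightedCount, sq, Finset.sum_mul_sum]
  refine Finset.sum_congr rfl fun k _ => Finset.sum_congr rfl fun l _ => ?_
  rw [Set.preimage_inter, Set.inter_indicator_mul]

theorem weightedCount_le_card_of_finite {Ω : Type*} {X : ℕ → Ω → ℕ} {ω : Ω}
    (hfin : (skipped X ω).Finite) (hK : 3 ≤ K) (n : ℕ) :
    weightedCount X K n ω ≤ hfin.toFinset.card := by
  classical
  calc weightedCount X K n ω
      ≤ ∑ k ∈ Finset.Ico K n, if k ∈ hfin.toFinset then (1 : ℝ) else 0 := by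
        refine Finset.sum_le_sum fun k hk => ?_
        have hlog := one_le_log (hK.trans (Finset.mem_Ico.1 hk).1)
        have hweight : 1 / Real.log k ≤ 1 := div_le_one_of_le₀ hlog (by linarith)
        have hskip : ω ∈ traj X ⁻¹' avoid k ↔ k ∈ skipped X ω := Iff.rfl
        simp only [hfin.mem_toFinset, Set.indicator_apply, hskip]
        split_ifs
        exacts [hweight, le_rfl]
    _ = ((Finset.Ico K n).filter (· ∈ hfin.toFinset)).card := Finset.sum_boole _ _
    _ ≤ hfin.toFinset.card := by
        gcongr
        exact fun k hk => (Finset.mem_filter.1 hk).2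

variable [IsFiniteMeasure P]

theorem IsWalk.integrable_weightedCount (hX : IsWalk P p X) (K n : ℕ) :
    Integrable (weightedCount X K n) P :=
  integrable_finsetSum _ fun k _ =>
    (integrable_const _).indicator (hX.measurableSet_preimage_avoid k)

theorem IsWalk.integral_weightedCount (hX : IsWalk P p X) (K n : ℕ) :
    ∫ ω, weightedCount X K n ω ∂P =
      ∑ k ∈ Finset.Ico K n, 1 / Real.log k * P.real (traj X ⁻¹' avoid k) := by
  have hmeas := hX.measurableSet_preimage_avoid
  simp only [weightedCount]
  rw [integral_finsetSum _ fun k _ => (integrable_const _).indicator (hmeas k)]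
  refine Finset.sum_congr rfl fun k _ => ?_
  rw [integral_indicator_const _ (hmeas k), smul_eq_mul, mul_comm]

theorem IsWalk.integrable_weightedCount_sq (hX : IsWalk P p X) (K n : ℕ) :
    Integrable (fun ω => weightedCount X K n ω ^ 2) P := by
  simp_rw [weightedCount_sq]
  exact integrable_finsetSum _ fun k _ => integrable_finsetSum _ fun l _ =>
    (integrable_const _).indicator
      ((hX.measurableSet_preimage_avoid k).inter (hX.measurableSet_preimage_avoid l))

theorem IsWalk.integral_weightedCount_sq (hX : IsWalk P p X) (K n : ℕ) :
    ∫ ω, weightedCount X K n ω ^ 2 ∂P =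
      ∑ k ∈ Finset.Ico K n, ∑ l ∈ Finset.Ico K n,
        1 / Real.log k * (1 / Real.log l) * P.real (traj X ⁻¹' (avoid k ∩ avoid l)) := by
  have hmeas : ∀ k l, MeasurableSet (traj X ⁻¹' (avoid k ∩ avoid l)) := fun k l =>
    (hX.measurableSet_preimage_avoid k).inter (hX.measurableSet_preimage_avoid l)
  have hint : ∀ k l, Integrable ((traj X ⁻¹' (avoid k ∩ avoid l)).indicator
      fun _ => 1 / Real.log k * (1 / Real.log l)) P := fun k l =>
    (integrable_const _).indicator (hmeas k l)
  simp_rw [weightedCount_sq]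
  rw [integral_finsetSum _ fun k _ => integrable_finsetSum _ fun l _ => hint k l]
  refine Finset.sum_congr rfl fun k _ => ?_
  rw [integral_finsetSum _ fun l _ => hint k l]
  refine Finset.sum_congr rfl fun l _ => ?_
  rw [integral_indicator_const _ (hmeas k l), smul_eq_mul, mul_comm]

theorem IsWalk.measureReal_avoid_le (hX : IsWalk P p X) (hξ : IsTailSolution p ξ)
    (h0 : ∀ᵐ ω ∂P, X 0 ω < k) :
    P.real (traj X ⁻¹' avoid k) ≤ P.real Set.univ / (D ξ k).toReal := by
  have hD : D ξ k ≠ 0 := (zero_lt_one.trans_le (one_le_D ξ k)).ne'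
  rw [measureReal_def, measureReal_def, ← ENNReal.toReal_div]
  exact ENNReal.toReal_mono (ENNReal.div_ne_top (measure_ne_top _ _) hD)
    (hX.measure_avoid_le hξ h0)

theorem UniformlyElliptic.le_mul_measureReal_avoid (hε : UniformlyElliptic ε p)
    (hξ : IsTailSolution p ξ) (hX : IsWalk P p X) (hk : 4 ≤ k) (h0 : ∀ᵐ ω ∂P, X 0 ω < k) :
    P.real Set.univ / (D ξ k).toReal ≤
      (jumpConst ε).toReal * P.real (traj X ⁻¹' avoid k) := by
  rw [measureReal_def, measureReal_def, ← ENNReal.toReal_div, ← ENNReal.toReal_mul]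
  exact ENNReal.toReal_mono (ENNReal.mul_ne_top (jumpConst_ne_top ε) (measure_ne_top _ _))
    (hε.le_mul_measure_avoid hξ hX hk h0)

theorem IsWalk.measureReal_avoid_inter_le (hX : IsWalk P p X) (hξ : IsTailSolution p ξ)
    (hkl : k < l) (h0 : ∀ᵐ ω ∂P, X 0 ω < k) (hk : D ξ k ≠ ∞) (hl : D ξ l ≠ ∞) :
    P.real (traj X ⁻¹' (avoid k ∩ avoid l)) ≤
      P.real Set.univ * (1 / (D ξ k).toReal * (1 / (D ξ l).toReal + growthRate ξ k l)) := by
  have hDl : D ξ l ≠ 0 := (zero_lt_one.trans_le (one_le_D ξ l)).ne'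
  have hmul : DFin ξ k l * P.real (traj X ⁻¹' (avoid k ∩ avoid l)) ≤
      P.real Set.univ / (D ξ l).toReal := by
    have := ENNReal.toReal_mono (ENNReal.div_ne_top (measure_ne_top _ _) hDl)
      (hX.mul_measure_avoid_inter_le hξ hkl h0)
    rwa [ENNReal.toReal_div, ENNReal.toReal_mul,
      ENNReal.toReal_ofReal (hξ.DFin_nonneg k l)] at this
  have hDFin_pos : 0 < DFin ξ k l := zero_lt_one.trans_le (hξ.one_le_DFin hkl)
  have hk_pos : 0 < (D ξ k).toReal := zero_lt_one.trans_le (one_le_toReal_D hk)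
  have hl_pos : 0 < (D ξ l).toReal := zero_lt_one.trans_le (one_le_toReal_D hl)
  have hsplit : 1 / (D ξ k).toReal * (1 / (D ξ l).toReal + growthRate ξ k l) =
      1 / (D ξ l).toReal / DFin ξ k l := by
    have hadd := hξ.toReal_D_add hkl.le hk hl
    rw [growthRate]
    field_simp
    linarith
  rw [hsplit, mul_div_assoc', mul_one_div, le_div_iff₀' hDFin_pos]
  exact hmul

theorem IsWalk.mul_measureReal_avoid_inter_le_of_lt (hX : IsWalk P p X) (hξ : IsTailSolution p ξ)
    (hkl : k < l) (h0 : ∀ᵐ ω ∂P, X 0 ω < k) (hk : D ξ k ≠ ∞) (hl : D ξ l ≠ ∞) :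
    1 / Real.log k * (1 / Real.log l) * P.real (traj X ⁻¹' (avoid k ∩ avoid l)) ≤
      P.real Set.univ * ((critTerm ξ k).toReal * (critTerm ξ l).toReal + pairExcess ξ k l) := by
  refine (mul_le_mul_of_nonneg_left (hX.measureReal_avoid_inter_le hξ hkl h0 hk hl)
    (mul_nonneg (one_div_nonneg.2 (Real.log_natCast_nonneg k))
      (one_div_nonneg.2 (Real.log_natCast_nonneg l)))).trans_eq ?_
  rw [pairExcess, toReal_critTerm, toReal_critTerm]
  ring

theorem IsWalk.mul_measureReal_avoid_le (hX : IsWalk P p X) (hξ : IsTailSolution p ξ)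
    (hk : 3 ≤ k) (h0 : ∀ᵐ ω ∂P, X 0 ω < k) :
    1 / Real.log k * (1 / Real.log k) * P.real (traj X ⁻¹' avoid k) ≤
      P.real Set.univ * (critTerm ξ k).toReal := by
  have hlog := one_le_log hk
  have hweight : 1 / Real.log k ≤ 1 := div_le_one_of_le₀ hlog (by linarith)
  calc 1 / Real.log k * (1 / Real.log k) * P.real (traj X ⁻¹' avoid k)
      ≤ 1 / Real.log k * 1 * (P.real Set.univ / (D ξ k).toReal) := by
        gcongr
        exact hX.measureReal_avoid_le hξ h0
    _ = P.real Set.univ * (critTerm ξ k).toReal := by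
        rw [toReal_critTerm]
        ring

theorem IsWalk.mul_measureReal_avoid_inter_le (hX : IsWalk P p X) (hξ : IsTailSolution p ξ)
    (hK : 3 ≤ K) (h0 : ∀ᵐ ω ∂P, X 0 ω < K) (hD : ∀ k, K ≤ k → D ξ k ≠ ∞) (hk : K ≤ k)
    (hl : K ≤ l) :
    1 / Real.log k * (1 / Real.log l) * P.real (traj X ⁻¹' (avoid k ∩ avoid l)) ≤
      P.real Set.univ * ((critTerm ξ k).toReal * (critTerm ξ l).toReal +
        pairExcess ξ k l + pairExcess ξ l k + if k = l then (critTerm ξ k).toReal else 0) := by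
  have hstart : ∀ j, K ≤ j → ∀ᵐ ω ∂P, X 0 ω < j := fun j hj => h0.mono fun ω hω => hω.trans_le hj
  rcases lt_trichotomy k l with hkl | rfl | hlk
  · rw [pairExcess_of_le ξ hkl.le, if_neg hkl.ne, add_zero, add_zero]
    exact hX.mul_measureReal_avoid_inter_le_of_lt hξ hkl (hstart k hk) (hD k hk) (hD l hl)
  · rw [Set.inter_self, pairExcess_of_le ξ le_rfl, if_pos rfl, add_zero, add_zero]
    refine (hX.mul_measureReal_avoid_le hξ (hK.trans hk) (hstart k hk)).trans ?_
    gcongr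
    exact le_add_of_nonneg_left (mul_self_nonneg _)
  · rw [Set.inter_comm, pairExcess_of_le ξ hlk.le, if_neg hlk.ne', add_zero, add_zero,
      mul_comm (1 / Real.log k), mul_comm (critTerm ξ k).toReal]
    exact hX.mul_measureReal_avoid_inter_le_of_lt hξ hlk (hstart l hl) (hD l hl) (hD k hk)

theorem IsWalk.integral_weightedCount_sq_le (hX : IsWalk P p X) (hξ : IsTailSolution p ξ)
    (hU : ∀ n, 1 ≤ n → 1 / ξ n ≤ 1) (hK : 3 ≤ K) (h0 : ∀ᵐ ω ∂P, X 0 ω < K)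
    (hD : ∀ k : ℕ, K ≤ k → D ξ k ≤ (k : ℝ≥0∞) ^ s) (n : ℕ) :
    ∫ ω, weightedCount X K n ω ^ 2 ∂P ≤
      P.real Set.univ * ((∑ k ∈ Finset.Ico K n, (critTerm ξ k).toReal) ^ 2 +
        (4 * s + 1) * ∑ k ∈ Finset.Ico K n, (critTerm ξ k).toReal) := by
  have hexcess : ∑ k ∈ Finset.Ico K n, ∑ l ∈ Finset.Ico K n, pairExcess ξ k l ≤
      2 * s * ∑ k ∈ Finset.Ico K n, (critTerm ξ k).toReal := by
    rw [Finset.mul_sum]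
    refine Finset.sum_le_sum fun k hk => ?_
    have hKk := (Finset.mem_Ico.1 hk).1
    exact hξ.sum_pairExcess_le hU (by omega) (hD k hKk) hk
  have hdiag : ∑ k ∈ Finset.Ico K n, ∑ l ∈ Finset.Ico K n,
      (if k = l then (critTerm ξ k).toReal else 0) =
        ∑ k ∈ Finset.Ico K n, (critTerm ξ k).toReal :=
    Finset.sum_congr rfl fun k hk => by rw [Finset.sum_ite_eq, if_pos hk]
  rw [hX.integral_weightedCount_sq]
  refine (Finset.sum_le_sum fun k hk => Finset.sum_le_sum fun l hl =>
    hX.mul_measureReal_avoid_inter_le hξ hK h0 (fun j hj => D_ne_top_of_le_pow (hD j hj))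
      (Finset.mem_Ico.1 hk).1 (Finset.mem_Ico.1 hl).1).trans ?_
  simp_rw [← Finset.mul_sum, Finset.sum_add_distrib]
  rw [Finset.sum_comm (f := fun k l => pairExcess ξ l k), ← Finset.sum_mul_sum, ← sq, hdiag]
  refine mul_le_mul_of_nonneg_left ?_ measureReal_nonneg
  linarith

theorem UniformlyElliptic.le_integral_weightedCount (hε : UniformlyElliptic ε p)
    (hξ : IsTailSolution p ξ) (hX : IsWalk P p X) (hK : 4 ≤ K) (h0 : ∀ᵐ ω ∂P, X 0 ω < K)
    (n : ℕ) :
    P.real Set.univ * ∑ k ∈ Finset.Ico K n, (critTerm ξ k).toReal ≤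
      (jumpConst ε).toReal * ∫ ω, weightedCount X K n ω ∂P := by
  rw [hX.integral_weightedCount, Finset.mul_sum, Finset.mul_sum]
  refine Finset.sum_le_sum fun k hk => ?_
  have hKk := (Finset.mem_Ico.1 hk).1
  have hskip := hε.le_mul_measureReal_avoid hξ hX (hK.trans hKk)
    (h0.mono fun ω hω => hω.trans_le hKk)
  calc P.real Set.univ * (critTerm ξ k).toReal
      = 1 / Real.log k * (P.real Set.univ / (D ξ k).toReal) := by
        rw [toReal_critTerm]
        ring
    _ ≤ 1 / Real.log k * ((jumpConst ε).toReal * P.real (traj X ⁻¹' avoid k)) :=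
        mul_le_mul_of_nonneg_left hskip (one_div_nonneg.2 (Real.log_natCast_nonneg k))
    _ = (jumpConst ε).toReal * (1 / Real.log k * P.real (traj X ⁻¹' avoid k)) := by ring

end SecondMoment

section ZeroOneCriteria

variable {Ω : Type*} [MeasurableSpace Ω] {P : Measure Ω} [IsFiniteMeasure P]

theorem le_measureReal_of_integral_sq_le {Z : Ω → ℝ} (hZm : Measurable Z) (hZ : Integrable Z P)
    (hZ2 : Integrable (fun ω => Z ω ^ 2) P) {m C : ℝ} (hm : 0 < m) (hC : 0 < C)
    (hmean : P.real Set.univ * m ≤ ∫ ω, Z ω ∂P)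
    (hsq : ∫ ω, Z ω ^ 2 ∂P ≤ C * P.real Set.univ * m ^ 2) :
    P.real Set.univ / (2 * C) ≤ P.real {ω | m / 4 ≤ Z ω} := by
  set B := {ω | m / 4 ≤ Z ω}
  have hB : MeasurableSet B := measurableSet_le measurable_const hZm
  -- AM-GM on `B`: `Z ≤ Z ^ 2 / (4 C m) + C m`.
  have hpointwise : ∀ ω, Z ω ≤ m / 4 + 1 / (4 * C * m) * Z ω ^ 2 +
      B.indicator (fun _ => C * m) ω := fun ω => by
    by_cases hω : ω ∈ B
    · have hsquare : 1 / (4 * C * m) * Z ω ^ 2 + C * m - Z ω =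
          1 / (4 * C * m) * (Z ω - 2 * C * m) ^ 2 := by
        field_simp
        ring
      have hsquare_nonneg : 0 ≤ 1 / (4 * C * m) * (Z ω - 2 * C * m) ^ 2 := by positivity
      rw [Set.indicator_of_mem hω]
      linarith
    · have hlt : Z ω < m / 4 := not_le.1 hω
      have hsquare_nonneg : 0 ≤ 1 / (4 * C * m) * Z ω ^ 2 := by positivity
      rw [Set.indicator_of_notMem hω]
      linarith
  have hint_sq : Integrable (fun ω => m / 4 + 1 / (4 * C * m) * Z ω ^ 2) P :=
    (integrable_const _).add (hZ2.const_mul _)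
  have hint_ind : Integrable (B.indicator fun _ => C * m) P := (integrable_const _).indicator hB
  have hint := integral_mono hZ (hint_sq.add hint_ind) hpointwise
  rw [integral_add' hint_sq hint_ind, integral_add (integrable_const _) (hZ2.const_mul _),
    integral_const, integral_const_mul, integral_indicator_const _ hB, smul_eq_mul,
    smul_eq_mul] at hint
  have hsq' : 1 / (4 * C * m) * ∫ ω, Z ω ^ 2 ∂P ≤ P.real Set.univ * m / 4 := by
    rw [one_div_mul_eq_div, div_le_iff₀ (by positivity)]
    linarith
  rw [div_le_iff₀ (by positivity)]
  refine le_of_mul_le_mul_right ?_ hm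
  linarith

theorem le_measureReal_frequently_mem {B : ℕ → Set Ω} (hB : ∀ n, MeasurableSet (B n)) {c : ℝ}
    (hc : ∀ᶠ n in atTop, c ≤ P.real (B n)) : c ≤ P.real {ω | ∃ᶠ n in atTop, ω ∈ B n} := by
  set T : ℕ → Set Ω := fun N => ⋃ n ∈ Set.Ici N, B n
  have hset : {ω | ∃ᶠ n in atTop, ω ∈ B n} = ⋂ N, T N := by
    ext ω
    simp [T, frequently_atTop]
  have hlim : Tendsto (fun N => P.real (T N)) atTop (𝓝 (P.real (⋂ N, T N))) := by
    refine (ENNReal.tendsto_toReal (measure_ne_top _ _)).comp (tendsto_measure_iInter_atTop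
      (fun N => (MeasurableSet.biUnion (Set.to_countable _) fun n _ => hB n).nullMeasurableSet) ?_
      ⟨0, measure_ne_top _ _⟩)
    exact fun a b hab => Set.biUnion_subset_biUnion_left fun n hn => le_trans hab hn
  rw [hset]
  refine ge_of_tendsto hlim (hc.mono fun N hN => hN.trans
    (measureReal_mono ?_ (measure_ne_top _ _)))
  exact Set.subset_biUnion_of_mem (u := B) Set.self_mem_Ici

theorem ae_mem_of_forall_mul_measureReal_le {ℱ : Filtration ℕ ‹MeasurableSpace Ω›} {A : Set Ω}
    (hA : MeasurableSet[⨆ t, ℱ t] A) {c : ℝ} (hc : 0 < c)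
    (h : ∀ t C, MeasurableSet[ℱ t] C → c * P.real C ≤ P.real (C ∩ A)) : ∀ᵐ ω ∂P, ω ∈ A := by
  have hle : (⨆ t, ℱ t) ≤ ‹MeasurableSpace Ω› := iSup_le ℱ.le
  let ind : Ω → ℝ := A.indicator 1
  have hind : Integrable ind P := (integrable_const 1).indicator (hle _ hA)
  have hcond : ∀ t, (fun _ => c) ≤ᵐ[P] P[ind | ℱ t] := fun t => by
    refine ae_le_of_ae_le_trim (hm := ℱ.le t) (ae_le_of_forall_setIntegral_le
      (integrable_const c) (integrable_condExp.trim _ stronglyMeasurable_condExp) fun C hC _ => ?_)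
    rw [← setIntegral_trim _ stronglyMeasurable_const hC,
      ← setIntegral_trim _ stronglyMeasurable_condExp hC, setIntegral_condExp _ hind hC,
      setIntegral_indicator (hle _ hA), setIntegral_const, smul_eq_mul, mul_comm]
    simpa using h t C hC
  have hlim := tendsto_ae_condExp (μ := P) (ℱ := ℱ) ind
  rw [condExp_of_stronglyMeasurable hle (stronglyMeasurable_one.indicator hA) hind] at hlim
  filter_upwards [hlim, ae_all_iff.2 hcond] with ω hω hge
  exact Set.mem_of_indicator_ne_zero (hc.trans_le (ge_of_tendsto' hω hge)).ne'

end ZeroOneCriteria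

section InfinitelyMany

variable {Ω : Type*} [MeasurableSpace Ω] {P : Measure Ω} {p ξ : ℕ → ℝ} {X : ℕ → Ω → ℕ}
  {ε : ℝ} {K n s : ℕ}

theorem measurableSet_infinite_avoid : MeasurableSet {x | {k | x ∈ avoid k}.Infinite} := by
  have hlimsup : {x | {k | x ∈ avoid k}.Infinite} = limsup avoid atTop := by
    ext x
    rw [mem_limsup_iff_frequently_mem, Nat.frequently_atTop_iff_infinite]
    rfl
  rw [hlimsup]
  exact .measurableSet_limsup measurableSet_avoid

theorem IsWalk.measurableSet_iSup_past_infinite_skipped (hX : IsWalk P p X) :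
    MeasurableSet[⨆ t, hX.past t] {ω | (skipped X ω).Infinite} :=
  @measurable_pi_lambda Ω ℕ _ (⨆ t, hX.past t) _ (traj X)
    (fun t => (hX.measurable_past (le_refl t)).mono (le_iSup _ t) le_rfl)
    _ measurableSet_infinite_avoid

theorem infinite_skipped_of_shift {Ω : Type*} {X : ℕ → Ω → ℕ} {ω : Ω} (t : ℕ)
    (h : (skipped (fun i => X (t + i)) ω).Infinite) : (skipped X ω).Infinite := by
  have hfin : (traj X ω '' Set.Iio t).Finite := (Set.finite_Iio t).image _
  refine (h.sdiff hfin).mono ?_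
  rintro k ⟨hafter, hbefore⟩ n hn
  rcases Nat.lt_or_ge n t with hnt | hnt
  · exact hbefore ⟨n, hnt, hn⟩
  · exact hafter (n - t) ((congrArg (X · ω) (Nat.add_sub_cancel' hnt)).trans hn)

variable [IsFiniteMeasure P]

theorem UniformlyElliptic.le_measureReal_weightedCount (hε : UniformlyElliptic ε p)
    (hξ : IsTailSolution p ξ) (hU : ∀ n, 1 ≤ n → 1 / ξ n ≤ 1) (hX : IsWalk P p X) (hK : 4 ≤ K)
    (h0 : ∀ᵐ ω ∂P, X 0 ω < K) (hD : ∀ k : ℕ, K ≤ k → D ξ k ≤ (k : ℝ≥0∞) ^ s)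
    (hn : 4 * s + 1 ≤ ∑ k ∈ Finset.Ico K n, (critTerm ξ k).toReal) :
    P.real Set.univ / (4 * (jumpConst ε).toReal ^ 2) ≤
      P.real {ω | (∑ k ∈ Finset.Ico K n, (critTerm ξ k).toReal) / (jumpConst ε).toReal / 4 ≤
        weightedCount X K n ω} := by
  set S := ∑ k ∈ Finset.Ico K n, (critTerm ξ k).toReal
  set κ := (jumpConst ε).toReal
  have hκ : 0 < κ := jumpConst_toReal_pos ε
  have hS : 0 < S := lt_of_lt_of_le (by positivity) hn
  have hmean : P.real Set.univ * (S / κ) ≤ ∫ ω, weightedCount X K n ω ∂P := by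
    rw [← mul_div_assoc, div_le_iff₀' hκ]
    exact hε.le_integral_weightedCount hξ hX hK h0 n
  have hsq : ∫ ω, weightedCount X K n ω ^ 2 ∂P ≤
      2 * κ ^ 2 * P.real Set.univ * (S / κ) ^ 2 :=
    calc ∫ ω, weightedCount X K n ω ^ 2 ∂P
        ≤ P.real Set.univ * (S ^ 2 + (4 * s + 1) * S) :=
          hX.integral_weightedCount_sq_le hξ hU (by omega) h0 hD n
      _ ≤ P.real Set.univ * (S ^ 2 + S * S) := by gcongr
      _ = 2 * κ ^ 2 * P.real Set.univ * (S / κ) ^ 2 := by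
          field_simp
          ring
  convert le_measureReal_of_integral_sq_le (hX.measurable_weightedCount K n)
    (hX.integrable_weightedCount K n) (hX.integrable_weightedCount_sq K n) (div_pos hS hκ)
    (by positivity) hmean hsq using 2
  ring

theorem UniformlyElliptic.le_measureReal_infinite_skipped_of_lt (hε : UniformlyElliptic ε p)
    (hξ : IsTailSolution p ξ) (hU : ∀ n, 1 ≤ n → 1 / ξ n ≤ 1) (hX : IsWalk P p X) (hK : 4 ≤ K)
    (h0 : ∀ᵐ ω ∂P, X 0 ω < K) (hD : ∀ k : ℕ, K ≤ k → D ξ k ≤ (k : ℝ≥0∞) ^ s)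
    (hcrit : critSum ξ = ∞) :
    P.real Set.univ / (4 * (jumpConst ε).toReal ^ 2) ≤
      P.real {ω | (skipped X ω).Infinite} := by
  set S : ℕ → ℝ := fun n => ∑ k ∈ Finset.Ico K (K + n), (critTerm ξ k).toReal
  have hS : Tendsto S atTop atTop := tendsto_sum_toReal_critTerm hcrit (by omega)
  refine (le_measureReal_frequently_mem
    (fun n => measurableSet_le measurable_const (hX.measurable_weightedCount K (K + n)))
    ((hS.eventually_ge_atTop (4 * s + 1)).mono fun n hn =>
      hε.le_measureReal_weightedCount hξ hU hX hK h0 hD hn)).trans (measureReal_mono ?_)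
  intro ω hω hfin
  have hfin' : (skipped X ω).Finite := hfin
  have hlarge : Tendsto (fun n => S n / (jumpConst ε).toReal / 4) atTop atTop :=
    (hS.atTop_div_const (jumpConst_toReal_pos ε)).atTop_div_const four_pos
  obtain ⟨n, hcount, hn⟩ := (Frequently.and_eventually hω
    (hlarge.eventually_gt_atTop (hfin'.toFinset.card : ℝ))).exists
  exact absurd (weightedCount_le_card_of_finite hfin' (by omega) (K + n))
    (not_le.2 (hn.trans_le hcount))

theorem UniformlyElliptic.le_measureReal_infinite_skipped (hε : UniformlyElliptic ε p)
    (hξ : IsTailSolution p ξ) (hU : ∀ n, 1 ≤ n → 1 / ξ n ≤ 1) (hX : IsWalk P p X)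
    (hD : ∀ᶠ n : ℕ in atTop, D ξ n ≤ (n : ℝ≥0∞) ^ s) (hcrit : critSum ξ = ∞) :
    P.real Set.univ / (4 * (jumpConst ε).toReal ^ 2) ≤
      P.real {ω | (skipped X ω).Infinite} := by
  obtain ⟨N, hN⟩ := eventually_atTop.1 hD
  have hlim : Tendsto (fun K => P.real (X 0 ⁻¹' Set.Iio K)) atTop (𝓝 (P.real Set.univ)) := by
    have hunion : ⋃ K, X 0 ⁻¹' Set.Iio K = Set.univ := by
      rw [← Set.preimage_iUnion, Set.iUnion_Iio, Set.preimage_univ]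
    rw [← hunion]
    exact (ENNReal.tendsto_toReal (measure_ne_top _ _)).comp (tendsto_measure_iUnion_atTop
      fun K L hKL => Set.preimage_mono (Set.Iio_subset_Iio hKL))
  refine le_of_tendsto (hlim.div_const _) ?_
  filter_upwards [eventually_ge_atTop N, eventually_ge_atTop 4] with K hNK hK
  have hstart : MeasurableSet[hX.past 0] (X 0 ⁻¹' Set.Iio K) :=
    hX.measurable_past (le_refl 0) measurableSet_Iio
  have hwalk : IsWalk (P.restrict (X 0 ⁻¹' Set.Iio K)) p X := by
    simpa only [zero_add] using hX.restrict_shift hstart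
  have hbound := hε.le_measureReal_infinite_skipped_of_lt hξ hU hwalk hK
    (ae_restrict_mem (hX.past.le 0 _ hstart)) (fun k hk => hN k (hNK.trans hk)) hcrit
  rw [measureReal_restrict_apply_univ] at hbound
  exact hbound.trans (ENNReal.toReal_mono (measure_ne_top _ _) (Measure.restrict_apply_le _ _))

theorem UniformlyElliptic.ae_infinite_skipped (hε : UniformlyElliptic ε p)
    (hξ : IsTailSolution p ξ) (hU : ∀ n, 1 ≤ n → 1 / ξ n ≤ 1) (hX : IsWalk P p X)
    (hD : ∀ᶠ n : ℕ in atTop, D ξ n ≤ (n : ℝ≥0∞) ^ s) (hcrit : critSum ξ = ∞) :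
    ∀ᵐ ω ∂P, (skipped X ω).Infinite := by
  have hκ := jumpConst_toReal_pos ε
  refine ae_mem_of_forall_mul_measureReal_le (A := {ω | (skipped X ω).Infinite})
    hX.measurableSet_iSup_past_infinite_skipped
    (c := 1 / (4 * (jumpConst ε).toReal ^ 2)) (by positivity) fun t C hC => ?_
  have hbound := hε.le_measureReal_infinite_skipped hξ hU (hX.restrict_shift hC) hD hcrit
  rw [measureReal_restrict_apply_univ, ← one_div_mul_eq_div] at hbound
  rw [Set.inter_comm, ← measureReal_restrict_apply' (hX.past.le t _ hC)]
  exact hbound.trans (measureReal_mono fun ω hω => infinite_skipped_of_shift t hω)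

end InfinitelyMany

theorem IsTailSolution.exists_uniformlyElliptic {p ξ : ℕ → ℝ} (hξ : IsTailSolution p ξ)
    {c : ℝ} (hc : 0 < c) (hp : ∀ n, 1 ≤ n → c ≤ p n) (hanti : ∀ n, 1 ≤ n → p (n + 1) ≤ p n) :
    ∃ ε, UniformlyElliptic ε p := by
  refine ⟨min c (1 - p 1), lt_min hc (sub_pos.2 (hξ.mem_Ioo le_rfl).2), fun n hn => ?_⟩
  have hp1 : p n ≤ p 1 := by
    induction n, hn using Nat.le_induction with
    | base => exact le_rfl
    | succ n hn ih => exact (hanti n hn).trans ih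
  exact ⟨(min_le_left _ _).trans (hp n hn), by linarith [min_le_right c (1 - p 1)]⟩

theorem eventually_mul_mul_log_le_pow_three (δ : ℝ) :
    ∀ᶠ n : ℕ in atTop, ENNReal.ofReal (δ * n * Real.log n) ≤ (n : ℝ≥0∞) ^ 3 := by
  filter_upwards [tendsto_natCast_atTop_atTop.eventually_ge_atTop δ] with n hn
  rw [← ENNReal.ofReal_natCast, ← ENNReal.ofReal_pow n.cast_nonneg]
  refine ENNReal.ofReal_le_ofReal ?_
  calc δ * n * Real.log n ≤ n * n * n := by
        gcongr
        exact Real.log_le_self n.cast_nonneg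
    _ = (n : ℝ) ^ 3 := by ring

end SkipWalk

theorem theorem1p1_general {Ω : Type*} [MeasurableSpace Ω] (P : Measure Ω) [IsFiniteMeasure P]
    (p : ℕ → ℝ)
    (hp : ∀ n, 1 ≤ n → 1 / 3 ≤ p n)
    (hp_anti : ∀ n, 1 ≤ n → p (n + 1) ≤ p n)
    (X : ℕ → Ω → ℕ) (hX : SkipWalk.IsWalk P p X)
    (ξ : ℕ → ℝ) (hξ : SkipWalk.IsTailSolution p ξ) :
    (SkipWalk.critSum ξ < ∞ → ∀ᵐ ω ∂P, (SkipWalk.skipped X ω).Finite) ∧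
    ((∃ s : ℕ, ∀ᶠ n : ℕ in atTop, SkipWalk.D ξ n ≤ (n : ℝ≥0∞) ^ s) →
      SkipWalk.critSum ξ = ∞ → ∀ᵐ ω ∂P, (SkipWalk.skipped X ω).Infinite) := by
  obtain ⟨ε, hε⟩ := hξ.exists_uniformlyElliptic (by norm_num) hp hp_anti
  have hU : ∀ n, 1 ≤ n → 1 / ξ n ≤ 1 := fun n hn => hξ.one_div_le_one hp hp_anti hn
  exact ⟨hε.ae_finite_skipped hξ hU hX, fun ⟨_, hD⟩ => hε.ae_infinite_skipped hξ hU hX hD⟩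

theorem theorem1p1 {Ω : Type*} [MeasurableSpace Ω] (P : Measure Ω) [IsProbabilityMeasure P]
    (r : ℕ → ℝ)
    (hr_range : ∀ n, 1 ≤ n → 0 ≤ r n ∧ r n < 2 / 3)
    (hr_anti : ∀ n, 1 ≤ n → r (n + 1) ≤ r n)
    (hr_lim : Tendsto r atTop (𝓝 0))
    (hr_diff : (fun n => r n - r (n + 1)) =O[atTop] (fun n => r n ^ 2))
    (X : ℕ → Ω → ℕ) (hX : SkipWalk.IsWalk P (fun n => 1 / 3 + r n) X)
    (ξ : ℕ → ℝ) (hξ : SkipWalk.IsTailSolution (fun n => 1 / 3 + r n) ξ) :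
    (SkipWalk.critSum ξ < ∞ → ∀ᵐ ω ∂P, (SkipWalk.skipped X ω).Finite) ∧
    ((∃ δ : ℝ, 0 < δ ∧
        ∀ᶠ n : ℕ in atTop, SkipWalk.D ξ n ≤ ENNReal.ofReal (δ * n * Real.log n)) →
      SkipWalk.critSum ξ = ∞ →
      11 / 27 ≤ P {ω | (SkipWalk.skipped X ω).Infinite}) := by
  obtain ⟨hfinite, hinfinite⟩ := theorem1p1_general P (fun n => 1 / 3 + r n)
    (fun n hn => le_add_of_nonneg_right (hr_range n hn).1)
    (fun n hn => add_le_add_right (hr_anti n hn) _) X hX ξ hξ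
  refine ⟨hfinite, fun ⟨δ, _, hδ⟩ hcrit => ?_⟩
  have hD : ∀ᶠ n : ℕ in atTop, SkipWalk.D ξ n ≤ (n : ℝ≥0∞) ^ 3 := by
    filter_upwards [hδ, SkipWalk.eventually_mul_mul_log_le_pow_three δ] with n using le_trans
  have hae : {ω | (SkipWalk.skipped X ω).Infinite} =ᵐ[P] Set.univ :=
    eventuallyEq_univ.2 (hinfinite ⟨3, hD⟩ hcrit)
  rw [measure_congr hae, measure_univ]
  exact ENNReal.div_le_of_le_mul (by norm_num)
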